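/- **Conventions.** All signatures contain equality; interpretations have nonempty domains and assign values to the variables $x_0,x_1,x_2,\ldots$. A theory $T$ consists of the interpretations satisfying a given set of sentences $Ax(T)$. $T$ is *decidable* if the set of $T$-satisfiable quantifier-free formulas is decidable (formulas being coded by Gödel numbers). The *spectrum* $\mathrm{Spec}(T,\varphi)$ of a quantifier-free formula $\varphi$ is the set of countable (finite or $\aleph_0$) cardinalities of $T$-interpretations satisfying $\varphi$. $T$ is *gentle* if there is an algorithm that, for every conjunction $\varphi$ of literals, outputs a boolean $b$ and a finite set $S\subset\{1,2,3,\ldots\}$ such that $\mathrm{Spec}(T,\varphi)=S$ if $b$ is true, and $\mathrm{Spec}(T,\varphi)=(\{1,2,3,\ldots\}\cup\{\aleph_0\})\setminus S$ if $b$ is false. For theories $T_1,T_2$ over disjoint signatures $\Sigma_1,\Sigma_2$ (sharing only equality), $T_1\oplus T_2$ is the theory over $\Sigma_1\cup\Sigma_2$ axiomatized by $Ax(T_1)\cup Ax(T_2)$. **The theory $T_=$.** Its signature has only the $0$-ary predicate symbols $P_1,P_2,\ldots$ (besides equality), and its axioms are $P_n\to\psi_{=n}$ for $n\ge 1$, where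 $\psi_{=n}$ says that the domain has exactly $n$ elements. **The theory $T_f$.** Let $f:\{1,2,3,\ldots\}\to\{0,1\}$ be *admissible*: $f$ is not computable, $f(1)=1$, and for every $k\ge1$ the function $f$ takes each of the values $0$ and $1$ on exactly half of the numbers $1,\ldots,2^k$. For $i\in\{0,1\}$ let $f_i(k)$ be the number of $j\in\{1,\ldots,k\}$ with $f(j)=i$. The signature of $T_f$ has only a unary function symbol $s$ (besides equality), and its axioms are, for $k\ge1$, $$\bigl[\psi^{=}_{\ge f_1(k)}\wedge\psi^{\neq}_{\ge f_0(k)}\bigr]\ \vee\ \bigvee_{i=1}^{k}\bigl[\psi^{=}_{=f_1(i)}\wedge\psi^{\neq}_{=f_0(i)}\bigr],$$ where $\psi^{=}_{\ge n}$ and $\psi^{=}_{=n}$ say that at least, respectively exactly, $n$ elements satisfy $s(x)=x$, and $\psi^{\neq}_{\ge n}$, $\psi^{\neq}_{=n}$ say the same for $\neg(s(x)=x)$. **Theorem.** There are decidable theories $T_1$ and $T_2$ over disjoint signatures such that $T_1$ is gentle but $T_1\oplus T_2$ is undecidable. Explicitly: admissible functions $f$ exist, and for every admissible $f$ the theories $T_1=T_=$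 and $T_2=T_f$ are decidable, $T_=$ is gentle, and $T_=\oplus T_f$ is undecidable. -/

import Mathlib

namespace TheoryCombination

open FirstOrder FirstOrder.Language

/-! ### Gödel numbering of terms and formulas -/

section Coding

variable {L : FirstOrder.Language.{0, 0}} [∀ n, Encodable (L.Functions n)] [∀ n, Encodable (L.Relations n)]

/-- The Gödel number of a term. -/
def termCode {α : Type} [Encodable α] : L.Term α → ℕ
  | .var x => Nat.pair 0 (Encodable.encode x)
  | .func (l := l) f ts =>
      Nat.pair 1 (Nat.pair l (Nat.pair (Encodable.encode f)
        (Encodable.encode (List.ofFn fun i => termCode (ts i)))))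

/-- The Gödel number of a formula (Mathlib's primitive connectives are `⊥`, `=`, relation symbols,
implication and the universal quantifier; the others are abbreviations). -/
def formulaCode {α : Type} [Encodable α] : ∀ {n : ℕ}, L.BoundedFormula α n → ℕ
  | _, .falsum => Nat.pair 0 0
  | _, .equal t₁ t₂ => Nat.pair 1 (Nat.pair (termCode t₁) (termCode t₂))
  | _, .rel (l := l) R ts =>
      Nat.pair 2 (Nat.pair l (Nat.pair (Encodable.encode R)
        (Encodable.encode (List.ofFn fun i => termCode (ts i)))))
  | _, .imp φ ψ => Nat.pair 3 (Nat.pair (formulaCode φ) (formulaCode ψ))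
  | _, .all φ => Nat.pair 4 (formulaCode φ)

end Coding

/-! ### Satisfiability, decidability, spectra, gentleness

A theory is given by its axiomatization, a set of sentences. Formulas have their free variables
among `x₀, x₁, x₂, …`, indexed by `ℕ`. An interpretation is a nonempty structure together with a
valuation of the variables. -/

section Theories

variable {L : FirstOrder.Language.{0, 0}}

/-- `φ` is `T`-satisfiable. -/
def TSat (T : L.Theory) (φ : L.Formula ℕ) : Prop :=
  ∃ (M : Theory.ModelType.{0, 0, 0} T) (v : ℕ → M), φ.Realize v

/-- `T` is decidable: the set of (Gödel numbers of) `T`-satisfiable quantifier-free formulas is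
decidable. -/
def DecidableTheory [∀ n, Encodable (L.Functions n)] [∀ n, Encodable (L.Relations n)]
    (T : L.Theory) : Prop :=
  ComputablePred fun c : ℕ =>
    ∃ φ : L.Formula ℕ, BoundedFormula.IsQF φ ∧ TSat T φ ∧ formulaCode φ = c

/-- The spectrum of `T` with respect to `φ`: the set of countable cardinalities of
`T`-interpretations that satisfy `φ`. -/
def Spec (T : L.Theory) (φ : L.Formula ℕ) : Set Cardinal.{0} :=
  {κ | κ ≤ Cardinal.aleph0 ∧
    ∃ (M : Theory.ModelType.{0, 0, 0} T) (v : ℕ → M), φ.Realize v ∧ Cardinal.mk M = κ}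

/-- Literals: atomic formulas and their negations. -/
inductive IsLiteral : L.Formula ℕ → Prop
  | pos {φ : L.Formula ℕ} (h : BoundedFormula.IsAtomic φ) : IsLiteral φ
  | neg {φ : L.Formula ℕ} (h : BoundedFormula.IsAtomic φ) : IsLiteral (Formula.not φ)

/-- Cubes: finite conjunctions of literals, the empty conjunction included. -/
inductive IsCube : L.Formula ℕ → Prop
  | top : IsCube ⊤
  | lit {φ : L.Formula ℕ} (h : IsLiteral φ) : IsCube φ
  | and {φ ψ : L.Formula ℕ} (hφ : IsCube φ) (hψ : IsCube ψ) : IsCube (φ ⊓ ψ)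

/-- The set of cardinals given by a finite list of natural numbers. -/
def listCardinals (S : List ℕ) : Set Cardinal.{0} := {κ | ∃ n ∈ S, (n : Cardinal.{0}) = κ}

/-- `T` is gentle: an algorithm computes from every cube `φ` a boolean `b` and a finite set `S` of
positive integers (as a list) such that the spectrum of `φ` is `S` if `b` is true, and is the
complement of `S` in `{1, 2, 3, …} ∪ {ℵ₀}` if `b` is false. -/
def Gentle [∀ n, Encodable (L.Functions n)] [∀ n, Encodable (L.Relations n)]
    (T : L.Theory) : Prop :=
  ∃ g : ℕ → Bool × List ℕ, Computable g ∧
    ∀ φ : L.Formula ℕ, IsCube φ →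
      (∀ n ∈ (g (formulaCode φ)).2, 0 < n) ∧
      ((g (formulaCode φ)).1 = true → Spec T φ = listCardinals (g (formulaCode φ)).2) ∧
      ((g (formulaCode φ)).1 = false →
        Spec T φ = {κ | 1 ≤ κ ∧ κ ≤ Cardinal.aleph0} \ listCardinals (g (formulaCode φ)).2)

/-- The combination `T₁ ⊕ T₂`: the theory over the union of the two (disjoint) signatures that is
axiomatized by the union of the axiomatizations. `L₁.sum L₂` is the disjoint union, in which the
only symbol shared by the two copies is the built-in equality. -/
def combine {L₁ L₂ : FirstOrder.Language.{0, 0}} (T₁ : L₁.Theory) (T₂ : L₂.Theory) : (L₁.sum L₂).Theory :=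
  (LHom.sumInl : L₁ →ᴸ L₁.sum L₂).onTheory T₁ ∪ (LHom.sumInr : L₂ →ᴸ L₁.sum L₂).onTheory T₂

instance {L₁ L₂ : FirstOrder.Language.{0, 0}} [∀ n, Encodable (L₁.Functions n)]
    [∀ n, Encodable (L₂.Functions n)] (n : ℕ) : Encodable ((L₁.sum L₂).Functions n) :=
  inferInstanceAs (Encodable (L₁.Functions n ⊕ L₂.Functions n))

instance {L₁ L₂ : FirstOrder.Language.{0, 0}} [∀ n, Encodable (L₁.Relations n)]
    [∀ n, Encodable (L₂.Relations n)] (n : ℕ) : Encodable ((L₁.sum L₂).Relations n) :=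
  inferInstanceAs (Encodable (L₁.Relations n ⊕ L₂.Relations n))

end Theories

/-! ### The two signatures -/

/-- Predicate symbols `P₁, P₂, …`, all of arity `0`. -/
inductive PredSym : ℕ → Type
  | P (n : ℕ+) : PredSym 0

/-- One function symbol `s`, of arity `1`. -/
inductive FunSym : ℕ → Type
  | s : FunSym 1

/-- The signature whose only symbols are the `0`-ary predicates `P₁, P₂, …`. -/
def sigP : FirstOrder.Language.{0, 0} := ⟨fun _ => Empty, PredSym⟩

/-- The signature whose only symbol is the unary function symbol `s`. -/
def sigS : FirstOrder.Language.{0, 0} := ⟨FunSym, fun _ => Empty⟩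

/-- `Pₙ` as a relation symbol of `sigP`. -/
def symP (n : ℕ+) : sigP.Relations 0 := PredSym.P n

/-- `s` as a function symbol of `sigS`. -/
def symS : sigS.Functions 1 := FunSym.s

/-- The symbol `Pₙ` has code `n`. -/
instance (k : ℕ) : Encodable (PredSym k) where
  encode | .P n => (n : ℕ)
  decode c :=
    match k with
    | 0 => if h : 0 < c then some (.P ⟨c, h⟩) else none
    | _ + 1 => none
  encodek := by
    rintro ⟨n⟩
    simp only [PNat.pos, dif_pos]
    rfl

/-- The symbol `s` has code `0`. -/
instance (k : ℕ) : Encodable (FunSym k) where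
  encode _ := 0
  decode c :=
    match k with
    | 1 => if c = 0 then some .s else none
    | _ => none
  encodek := by
    rintro ⟨⟩
    simp

instance (n : ℕ) : Encodable (sigP.Functions n) := inferInstanceAs (Encodable Empty)
instance (n : ℕ) : Encodable (sigP.Relations n) := inferInstanceAs (Encodable (PredSym n))
instance (n : ℕ) : Encodable (sigS.Functions n) := inferInstanceAs (Encodable (FunSym n))
instance (n : ℕ) : Encodable (sigS.Relations n) := inferInstanceAs (Encodable Empty)

/-! ### The theory `T₌`, axiomatized by the sentences `Pₙ → ψ₌ₙ` for `n ≥ 1` -/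

/-- `ψ_{≤ n}`: `∃ x₁ … xₙ, ∀ y, y = x₁ ∨ … ∨ y = xₙ`. -/
noncomputable def psiLe (L : FirstOrder.Language.{0, 0}) (n : ℕ) : L.Sentence :=
  (BoundedFormula.iSup fun i : Fin n =>
    ((&(Fin.last n) : L.Term (Empty ⊕ Fin (n + 1))) =' &(Fin.castSucc i))).all.exs

/-- `ψ_{= n}`: there are exactly `n` elements (`Sentence.cardGe L n` is `ψ_{≥ n}`). -/
noncomputable def psiEq (L : FirstOrder.Language.{0, 0}) (n : ℕ) : L.Sentence :=
  Sentence.cardGe L n ⊓ psiLe L n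

/-- The atomic sentence `Pₙ`. -/
def predAtom (n : ℕ+) : sigP.Sentence :=
  (symP n).formula Fin.elim0

/-- The theory `T₌`. -/
noncomputable def Teq : sigP.Theory :=
  Set.range fun n : ℕ+ => Formula.imp (predAtom n) (psiEq sigP n)

/-! ### The theory `T_f` -/

/-- `s(t) = t`. -/
def fixF {n : ℕ} (t : sigS.Term (Empty ⊕ Fin n)) : sigS.BoundedFormula Empty n :=
  symS.apply₁ t =' t

/-- `¬ s(t) = t`. -/
def nonfixF {n : ℕ} (t : sigS.Term (Empty ⊕ Fin n)) : sigS.BoundedFormula Empty n :=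
  (fixF t).not

/-- `x₁, …, xₙ` are pairwise distinct. -/
noncomputable def distinctF (n : ℕ) : sigS.BoundedFormula Empty n :=
  BoundedFormula.iInf fun p : {p : Fin n × Fin n // p.1 < p.2} =>
    ((&p.1.1 : sigS.Term (Empty ⊕ Fin n)) =' &p.1.2).not

/-- At least `n` elements satisfy `q`. -/
noncomputable def atLeastF (q : ∀ {m : ℕ}, sigS.Term (Empty ⊕ Fin m) → sigS.BoundedFormula Empty m)
    (n : ℕ) : sigS.Sentence :=
  (distinctF n ⊓ BoundedFormula.iInf fun i : Fin n => q (&i)).exs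

/-- Exactly `n` elements satisfy `q`. -/
noncomputable def exactlyF (q : ∀ {m : ℕ}, sigS.Term (Empty ⊕ Fin m) → sigS.BoundedFormula Empty m)
    (n : ℕ) : sigS.Sentence :=
  (distinctF n ⊓ (BoundedFormula.iInf fun i : Fin n => q (&i)) ⊓
    ((q (&(Fin.last n))).imp (BoundedFormula.iSup fun i : Fin n =>
      ((&(Fin.last n) : sigS.Term (Empty ⊕ Fin (n + 1))) =' &(Fin.castSucc i)))).all).exs

/-- `f_i(k)`: the number of `j ∈ {1, …, k}` with `f(j) = i`. -/
def countVal (f : ℕ+ → Fin 2) (i : Fin 2) (k : ℕ+) : ℕ :=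
  ((Finset.Icc 1 k).filter fun j => f j = i).card

/-- The functions `f` from which `T_f` is built: `f` is not computable, `f(1) = 1`, and for every
`k ≥ 1`, `f` takes the values `0` and `1` equally often on `{1, …, 2ᵏ}`. -/
structure Admissible (f : ℕ+ → Fin 2) : Prop where
  not_computable : ¬ Computable fun n : ℕ => f n.succPNat
  map_one : f 1 = 1
  balanced : ∀ k : ℕ, 1 ≤ k → countVal f 0 (2 ^ k) = countVal f 1 (2 ^ k)

/-- The theory `T_f`, with one axiom for each `k ≥ 1`. -/
noncomputable def Tf (f : ℕ+ → Fin 2) : sigS.Theory :=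
  Set.range fun k : ℕ+ =>
    (atLeastF fixF (countVal f 1 k) ⊓ atLeastF nonfixF (countVal f 0 k)) ⊔
      Formula.iSup fun i : Finset.Icc (1 : ℕ+) k =>
        (exactlyF fixF (countVal f 1 i) ⊓ exactlyF nonfixF (countVal f 0 i) : sigS.Sentence)

end TheoryCombination

namespace TheoryCombination

open FirstOrder FirstOrder.Language

/-! In the combination, `Pₙ` fixes the domain size at `n`, and a model of `T_f` with `n` elements
has exactly `f₁(n)` fixed points of `s`. So `Pₙ` together with "`x₀, …, xₘ₋₁` are distinct fixed
points" is satisfiable iff `m ≤ f₁(n)` (`tSat_queryF_iff`). A decision procedure would thus compute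
`f` value by value (`not_decidableTheory_combine`).

Neither theory alone reveals `f`. A quantifier-free formula speaks of finitely many terms, so if it
is satisfiable at all it holds on a small finite structure (`funSat_of_realize`). That structure
embeds in one with infinitely many fixed and infinitely many non-fixed points, which satisfies every
axiom of `T_f` (`tSat_Tf_of_funSat`). Hence `T_f`-satisfiability is plain satisfiability, whatever
`f` is.

For `T₌`, a formula with code `c` mentions only variables and predicates of index below `c`. All
sizes above `c`, and `ℵ₀`, therefore behave alike (`predSat_iff_of_le`, `aleph0_mem_Spec_Teq`), so a
spectrum is finite or cofinite and is found by testing the sizes up to `c + 1`.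

Both decision procedures are primitive recursive on Gödel numbers: finite structures and valuations
are numbers read in base `b`, and `qfEval` computes truth values. -/

/-! ### Evaluating quantifier-free formulas on their Gödel numbers -/

section Evaluation

variable {α : Type*}

/-- Evaluation of an atomic formula from its Gödel number, given an evaluation `tv` of term codes
and an evaluation `rv` of codes of atoms other than equations. -/
def atomEval (tv : α → ℕ → Option ℕ) (rv : α → ℕ → Option Bool) (a : α) (c : ℕ) : Option Bool :=
  if c = 0 then some false
  else if c.unpair.1 = 1 then
    (tv a c.unpair.2.unpair.1).bind fun x => (tv a c.unpair.2.unpair.2).map fun y => decide (x = y)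
  else if c.unpair.1 = 2 then rv a c.unpair.2
  else none

theorem lt_of_unpair_fst {c k : ℕ} (h : c.unpair.1 = k + 1) :
    c.unpair.2.unpair.1 < c ∧ c.unpair.2.unpair.2 < c := by
  have h1 := Nat.unpair_add_le c
  have h2 := Nat.unpair_left_le c.unpair.2
  have h3 := Nat.unpair_right_le c.unpair.2
  omega

/-- Evaluation of a quantifier-free formula from its Gödel number; the value is `none` if the number
is not a code. -/
def qfEval (tv : α → ℕ → Option ℕ) (rv : α → ℕ → Option Bool) (a : α) (c : ℕ) : Option Bool :=
  if _h : c.unpair.1 = 3 then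
    (qfEval tv rv a c.unpair.2.unpair.1).bind fun x =>
      (qfEval tv rv a c.unpair.2.unpair.2).map fun y => !x || y
  else atomEval tv rv a c
termination_by c
decreasing_by
  · exact (lt_of_unpair_fst _h).1
  · exact (lt_of_unpair_fst _h).2

variable [Primcodable α] {tv : α → ℕ → Option ℕ} {rv : α → ℕ → Option Bool}

theorem primrec_atomEval (ht : Primrec₂ tv) (hr : Primrec₂ rv) : Primrec₂ (atomEval tv rv) := by
  have hc : Primrec fun p : α × ℕ => p.2.unpair := Primrec.unpair.comp Primrec.snd
  have hc2 : Primrec fun p : α × ℕ => p.2.unpair.2.unpair :=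
    Primrec.unpair.comp (Primrec.snd.comp hc)
  refine Primrec.ite (Primrec.eq.comp Primrec.snd (Primrec.const 0)) (Primrec.const _) ?_
  refine Primrec.ite (Primrec.eq.comp (Primrec.fst.comp hc) (Primrec.const 1)) ?_ ?_
  · refine Primrec.option_bind (ht.comp Primrec.fst (Primrec.fst.comp hc2)) ?_
    refine Primrec.option_map (ht.comp (Primrec.fst.comp Primrec.fst)
      (Primrec.snd.comp (hc2.comp Primrec.fst))) ?_
    exact Primrec.eq.decide.comp (Primrec.snd.comp Primrec.fst) Primrec.snd
  · exact Primrec.ite (Primrec.eq.comp (Primrec.fst.comp hc) (Primrec.const 2))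
      (hr.comp Primrec.fst (Primrec.snd.comp hc)) (Primrec.const _)

theorem primrec_qfEval (ht : Primrec₂ tv) (hr : Primrec₂ rv) : Primrec₂ (qfEval tv rv) := by
  -- Course-of-values recursion: `l` lists the values at all smaller numbers, so `l.length` is the
  -- current argument.
  let g : α → List (Option Bool) → Option (Option Bool) := fun a l =>
    some (if l.length.unpair.1 = 3 then
      (l.getD l.length.unpair.2.unpair.1 none).bind fun x =>
        (l.getD l.length.unpair.2.unpair.2 none).map fun y => !x || y
    else atomEval tv rv a l.length)
  refine Primrec.nat_strong_rec (g := g) (qfEval tv rv) ?_ ?_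
  · have hc : Primrec fun p : α × List (Option Bool) => p.2.length.unpair :=
      Primrec.unpair.comp (Primrec.list_length.comp Primrec.snd)
    have hc2 : Primrec fun p : α × List (Option Bool) => p.2.length.unpair.2.unpair :=
      Primrec.unpair.comp (Primrec.snd.comp hc)
    refine Primrec.option_some.comp (Primrec.ite
      (Primrec.eq.comp (Primrec.fst.comp hc) (Primrec.const 3)) ?_ ?_)
    · refine Primrec.option_bind
        ((Primrec.list_getD none).comp Primrec.snd (Primrec.fst.comp hc2)) ?_
      refine Primrec.option_map ((Primrec.list_getD none).comp (Primrec.snd.comp Primrec.fst)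
        (Primrec.snd.comp (hc2.comp Primrec.fst))) ?_
      exact Primrec.or.comp (Primrec.not.comp (Primrec.snd.comp Primrec.fst)) Primrec.snd
    · exact (primrec_atomEval ht hr).comp Primrec.fst (Primrec.list_length.comp Primrec.snd)
  · intro a n
    rw [qfEval]
    by_cases h : n.unpair.1 = 3
    · have := lt_of_unpair_fst h
      simp [g, h, List.getD, this.1, this.2]
    · simp [g, h]

end Evaluation

/-! ### Searching for a finite sequence of numbers -/

/-- The `i`-th digit of `a` in base `b`. -/
def digit (b a i : ℕ) : ℕ := a / b ^ i % b

theorem primrec_pow : Primrec₂ fun a b : ℕ => a ^ b := by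
  have h : Primrec₂ fun a b : ℕ => (Nat.rec 1 (fun _ x => x * a) b : ℕ) :=
    Primrec.nat_rec (f := fun _ : ℕ => 1) (g := fun a p => p.2 * a) (Primrec.const 1)
      (Primrec.nat_mul.comp (Primrec.snd.comp Primrec.snd) Primrec.fst)
  refine h.of_eq fun a b => ?_
  induction b with
  | zero => rfl
  | succ b ih => rw [pow_succ, ← ih]

theorem primrec_digit : Primrec fun p : ℕ × ℕ × ℕ => digit p.1 p.2.1 p.2.2 :=
  Primrec.nat_mod.comp (Primrec.nat_div.comp (Primrec.fst.comp Primrec.snd)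
    (primrec_pow.comp Primrec.fst (Primrec.snd.comp Primrec.snd))) Primrec.fst

/-- Turns the search for a finite valuation or operation into a bounded search for one number.
Induction on the length: the new value becomes the leading digit and leaves the lower digits
unchanged. -/
theorem exists_digits {b : ℕ} (k : ℕ) (g : ℕ → ℕ) (hg : ∀ i < k, g i < b) :
    ∃ a < b ^ k, ∀ i < k, digit b a i = g i := by
  induction k with
  | zero => exact ⟨0, by simp, by simp⟩
  | succ k ih =>
    obtain ⟨a, ha, hd⟩ := ih fun i hi => hg i (by omega)
    have hk := hg k (by omega)
    refine ⟨a + b ^ k * g k, ?_, fun i hi => ?_⟩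
    · calc a + b ^ k * g k < b ^ k + b ^ k * g k := by omega
        _ = b ^ k * (g k + 1) := by ring
        _ ≤ b ^ k * b := Nat.mul_le_mul_left _ hk
        _ = b ^ (k + 1) := (pow_succ _ _).symm
    · have hb : 0 < b := by omega
      rcases Nat.lt_succ_iff_lt_or_eq.1 hi with h | rfl
      · rw [← hd i h]
        obtain ⟨d, rfl⟩ := Nat.exists_eq_add_of_lt h
        have : b ^ (i + d + 1) * g (i + d + 1) = b ^ i * (b * (b ^ d * g (i + d + 1))) := by ring
        rw [digit, digit, this, Nat.add_mul_div_left _ _ (pow_pos hb _), Nat.add_mul_mod_self_left]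
      · rw [digit, Nat.add_mul_div_left _ _ (pow_pos hb _), Nat.div_eq_of_lt ha, zero_add,
          Nat.mod_eq_of_lt hk]

theorem digit_lt {b : ℕ} (hb : 0 < b) (a i : ℕ) : digit b a i < b := Nat.mod_lt _ hb

/-- Bounded search is primitive recursive in the bound and in parameters. -/
theorem primrecPred_exists_lt {α : Type*} [Primcodable α] {R : α → ℕ → Prop} (hR : PrimrecRel R)
    {b : α → ℕ} (hb : Primrec b) : PrimrecPred fun a => ∃ x < b a, R a x :=
  by
  have h : PrimrecRel fun x a => R a x := hR.comp Primrec.snd Primrec.fst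
  exact (h.exists_mem_list.comp (Primrec.list_range.comp hb) Primrec.id).of_eq (by simp)

/-- Codes of variables. -/
def varDecode (c : ℕ) : Option ℕ :=
  if c.unpair.1 = 0 ∧ c.unpair.2 % 2 = 0 then some (c.unpair.2 / 2) else none

theorem primrec_varDecode : Primrec varDecode :=
  Primrec.ite
    (PrimrecPred.and
      (Primrec.eq.comp (Primrec.fst.comp Primrec.unpair) (Primrec.const 0))
      (Primrec.eq.comp (Primrec.nat_mod.comp (Primrec.snd.comp Primrec.unpair) (Primrec.const 2))
        (Primrec.const 0)))
    (Primrec.option_some.comp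
      (Primrec.nat_div.comp (Primrec.snd.comp Primrec.unpair) (Primrec.const 2)))
    (Primrec.const none)

/-! ### Correctness of the evaluation -/

section Correctness

variable {L : FirstOrder.Language.{0, 0}} [∀ n, Encodable (L.Functions n)]

/-- `Sum.inl` is encoded by doubling, hence the parity test and the halving in `varDecode`. -/
theorem varDecode_termCode (i : ℕ) :
    varDecode (termCode (Term.var (Sum.inl i) : L.Term (ℕ ⊕ Fin 0))) = some i := by
  simp [varDecode, termCode]

theorem termCode_of_varDecode {c i : ℕ} (h : varDecode c = some i) :
    termCode (Term.var (Sum.inl i) : L.Term (ℕ ⊕ Fin 0)) = c := by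
  simp only [varDecode, Option.ite_none_right_eq_some, Option.some.injEq] at h
  obtain ⟨⟨h1, h2⟩, rfl⟩ := h
  have : 2 * (c.unpair.2 / 2) = c.unpair.2 := by omega
  simp only [termCode, Encodable.encode_inl, Encodable.encode_nat, this]
  rw [← h1, Nat.pair_unpair]

/-- Codes bound indices, so a formula can only mention variables of index below its own code. -/
theorem lt_termCode_of_var {i : ℕ} :
    i ≤ termCode (Term.var (Sum.inl i) : L.Term (ℕ ⊕ Fin 0)) := by
  simp only [termCode, Encodable.encode_inl, Encodable.encode_nat]
  have := Nat.right_le_pair 0 (2 * i)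
  omega

theorem termCode_injective {β : Type} [Encodable β] :
    Function.Injective (termCode : L.Term β → ℕ) := by
  intro t
  induction t with
  | var x =>
    intro t' h
    cases t' with
    | var y =>
      simp only [termCode, Nat.pair_eq_pair, Encodable.encode_inj, true_and] at h
      rw [h]
    | func => simp [termCode] at h
  | @func l F ts ih =>
    intro t' h
    cases t' with
    | var => simp [termCode] at h
    | @func l' F' ts' =>
      simp only [termCode, Nat.pair_eq_pair, true_and] at h
      obtain ⟨rfl, hF, hts⟩ := h
      obtain rfl := Encodable.encode_injective hF
      have hts' := List.ofFn_injective (Encodable.encode_injective hts)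
      congr 1
      exact funext fun i => ih i (congrFun hts' i)

variable [∀ n, Encodable (L.Relations n)]

/-- The code of the atom `R(t₁, …, tₗ)` without its leading tag. -/
def relCode {l : ℕ} (R : L.Relations l) (ts : Fin l → L.Term (ℕ ⊕ Fin 0)) : ℕ :=
  Nat.pair l (Nat.pair (Encodable.encode R) (Encodable.encode (List.ofFn fun i => termCode (ts i))))

/-- The tags of equations, relations and implications are positive, which makes the codes of their
parts strictly smaller. -/
theorem right_lt_pair {k m : ℕ} (hk : 0 < k) : m < Nat.pair k m := by
  have := Nat.add_le_pair k m
  omega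

theorem pair_pos {k : ℕ} (m : ℕ) (hk : 0 < k) : Nat.pair k m ≠ 0 :=
  (Nat.zero_le m).trans_lt (right_lt_pair hk) |>.ne'

/-- `DecidableTheory` speaks of some formula with a given code; injectivity identifies it with the
formula intended. -/
theorem formulaCode_injective {β : Type} [Encodable β] {n : ℕ} :
    Function.Injective (formulaCode : L.BoundedFormula β n → ℕ) := by
  intro φ
  induction φ with
  | falsum =>
    intro ψ h
    cases ψ <;> simp [formulaCode] at h
    rfl
  | equal t₁ t₂ =>
    intro ψ h
    cases ψ <;> simp only [formulaCode, Nat.pair_eq_pair, true_and] at h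
    case equal => rw [termCode_injective h.1, termCode_injective h.2]
    all_goals exact absurd h.1 (by decide)
  | @rel n l R ts =>
    intro ψ h
    cases ψ <;> simp only [formulaCode, Nat.pair_eq_pair, true_and] at h
    case rel =>
      obtain ⟨rfl, hR, hts⟩ := h
      obtain rfl := Encodable.encode_injective hR
      have hts' := List.ofFn_injective (Encodable.encode_injective hts)
      congr 1
      exact funext fun i => termCode_injective (congrFun hts' i)
    all_goals exact absurd h.1 (by decide)
  | imp φ₁ φ₂ ih₁ ih₂ =>
    intro ψ h
    cases ψ <;> simp only [formulaCode, Nat.pair_eq_pair, true_and] at h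
    case imp => rw [ih₁ h.1, ih₂ h.2]
    all_goals exact absurd h.1 (by decide)
  | all φ ih =>
    intro ψ h
    cases ψ <;> simp only [formulaCode, Nat.pair_eq_pair, true_and] at h
    case all => rw [ih h]
    all_goals exact absurd h.1 (by decide)

variable {α : Type*} {tv : α → ℕ → Option ℕ} {rv : α → ℕ → Option Bool}

/-- If the evaluations of terms and atoms agree with a structure on all codes less than the code of
`φ`, then `qfEval` computes the truth value of `φ`. -/
theorem qfEval_formulaCode {M : Type*} [L.Structure M] (w : ℕ → M) (a : α) (N : ℕ)
    (ht : ∀ t t' : L.Term (ℕ ⊕ Fin 0), termCode t < N → termCode t' < N →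
      ∃ x y, tv a (termCode t) = some x ∧ tv a (termCode t') = some y ∧
        (x = y ↔ t.realize (Sum.elim w default) = t'.realize (Sum.elim w default)))
    (hr : ∀ {l : ℕ} (R : L.Relations l) (ts : Fin l → L.Term (ℕ ⊕ Fin 0)), relCode R ts < N →
      ∃ b : Bool, rv a (relCode R ts) = some b ∧
        (b = true ↔ Structure.RelMap R fun i => (ts i).realize (Sum.elim w default)))
    (φ : L.Formula ℕ) (hφ : BoundedFormula.IsQF φ) (hc : formulaCode φ ≤ N) :
    ∃ b : Bool, qfEval tv rv a (formulaCode φ) = some b ∧ (b = true ↔ φ.Realize w) := by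
  induction hφ with
  | falsum =>
    refine ⟨false, ?_, by simp [Formula.Realize, BoundedFormula.Realize]⟩
    rw [qfEval]
    simp [formulaCode, atomEval, Nat.pair]
  | of_isAtomic h =>
    rcases h with ⟨t, t'⟩ | ⟨R, ts⟩
    · simp only [Term.bdEqual, formulaCode] at hc ⊢
      have hlt : Nat.pair (termCode t) (termCode t') < N := lt_of_lt_of_le (right_lt_pair (by decide)) hc
      obtain ⟨x, y, hx, hy, hxy⟩ := ht t t' ((Nat.left_le_pair _ _).trans_lt hlt)
        ((Nat.right_le_pair _ _).trans_lt hlt)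
      refine ⟨decide (x = y), ?_, ?_⟩
      · rw [qfEval]
        simp [atomEval, pair_pos, hx, hy]
      · rw [decide_eq_true_iff, hxy]
        exact Iff.rfl
    · simp only [Relations.boundedFormula, formulaCode] at hc ⊢
      obtain ⟨b, hb, hbR⟩ := hr R ts (lt_of_lt_of_le (right_lt_pair (by decide)) hc)
      refine ⟨b, ?_, hbR⟩
      rw [qfEval]
      rw [relCode] at hb
      simp [atomEval, pair_pos, hb]
  | imp h₁ h₂ ih₁ ih₂ =>
    simp only [formulaCode] at hc ⊢
    have hlt := lt_of_lt_of_le (right_lt_pair (by decide)) hc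
    obtain ⟨b₁, e₁, r₁⟩ := ih₁ ((Nat.left_le_pair _ _).trans hlt.le)
    obtain ⟨b₂, e₂, r₂⟩ := ih₂ ((Nat.right_le_pair _ _).trans hlt.le)
    refine ⟨!b₁ || b₂, ?_, ?_⟩
    · rw [qfEval]
      simp [e₁, e₂]
    · simp only [Formula.Realize, BoundedFormula.realize_imp] at r₁ r₂ ⊢
      rw [← r₁, ← r₂]
      cases b₁ <;> cases b₂ <;> simp

/-- If the evaluations of terms and atoms succeed on codes only, then so does `qfEval`. -/
theorem exists_formulaCode_of_qfEval (a : α)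
    (ht : ∀ c x, tv a c = some x → ∃ t : L.Term (ℕ ⊕ Fin 0), termCode t = c)
    (hr : ∀ c b, rv a c = some b →
      ∃ (l : ℕ) (R : L.Relations l) (ts : Fin l → L.Term (ℕ ⊕ Fin 0)), relCode R ts = c)
    (c : ℕ) (b : Bool) (hc : qfEval tv rv a c = some b) :
    ∃ φ : L.Formula ℕ, BoundedFormula.IsQF φ ∧ formulaCode φ = c := by
  induction c using Nat.strong_induction_on generalizing b with
  | _ c ih =>
    rw [qfEval] at hc
    have hpair : Nat.pair c.unpair.1 c.unpair.2 = c := Nat.pair_unpair c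
    have hpair' : Nat.pair c.unpair.2.unpair.1 c.unpair.2.unpair.2 = c.unpair.2 :=
      Nat.pair_unpair _
    split_ifs at hc with h
    · simp only [Option.bind_eq_some_iff, Option.map_eq_some_iff] at hc
      obtain ⟨x, hx, y, hy, -⟩ := hc
      obtain ⟨φ, hφ, hφc⟩ := ih _ (lt_of_unpair_fst h).1 _ hx
      obtain ⟨ψ, hψ, hψc⟩ := ih _ (lt_of_unpair_fst h).2 _ hy
      refine ⟨φ.imp ψ, hφ.imp hψ, ?_⟩
      rw [formulaCode, hφc, hψc, hpair', ← h, hpair]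
    · simp only [atomEval] at hc
      split_ifs at hc with h0 h1 h2
      · exact ⟨⊥, BoundedFormula.isQF_bot, by subst h0; rfl⟩
      · simp only [Option.bind_eq_some_iff, Option.map_eq_some_iff] at hc
        obtain ⟨x, hx, y, hy, -⟩ := hc
        obtain ⟨t, ht1⟩ := ht _ _ hx
        obtain ⟨t', ht2⟩ := ht _ _ hy
        refine ⟨t.bdEqual t', (BoundedFormula.IsAtomic.equal t t').isQF, ?_⟩
        rw [Term.bdEqual, formulaCode, ht1, ht2, hpair', ← h1, hpair]
      · obtain ⟨l, R, ts, hR⟩ := hr _ _ hc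
        refine ⟨R.boundedFormula ts, (BoundedFormula.IsAtomic.rel R ts).isQF, ?_⟩
        rw [relCode] at hR
        rw [Relations.boundedFormula, formulaCode, hR, ← h2, hpair]

end Correctness

/-! ### The theory `T₌` -/

theorem realize_psiEq {L : FirstOrder.Language.{0, 0}} {M : Type} [L.Structure M] [Nonempty M]
    (n : ℕ) : M ⊨ psiEq L n ↔ Cardinal.mk M = n := by
  have hle : M ⊨ psiLe L n ↔ Cardinal.mk M ≤ n := by
    rw [psiLe, Sentence.Realize, BoundedFormula.realize_exs]
    simp only [BoundedFormula.realize_all, BoundedFormula.realize_iSup,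
      BoundedFormula.realize_bdEqual, Term.realize_var, Sum.elim_inr, Function.comp_apply,
      Fin.snoc_last, Fin.snoc_castSucc]
    constructor
    · rintro ⟨xs, h⟩
      have hs : Function.Surjective xs := fun a => (h a).imp fun i hi => hi.symm
      simpa using Cardinal.mk_le_of_surjective hs
    · intro h
      rw [← Cardinal.mk_fin] at h
      obtain ⟨e⟩ := Cardinal.le_def _ _ |>.1 h
      -- A left inverse of an embedding into `Fin n` enumerates `M`; it exists because `M` is
      -- nonempty.
      refine ⟨Function.invFun e, fun a => ⟨e a, ?_⟩⟩
      rw [Function.leftInverse_invFun e.injective]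
  have : M ⊨ psiEq L n ↔ M ⊨ Sentence.cardGe L n ∧ M ⊨ psiLe L n := by
    simp only [psiEq, Sentence.Realize, Formula.Realize, BoundedFormula.realize_inf]
  rw [this, Sentence.realize_cardGe, hle, le_antisymm_iff, and_comm]

/-- The structure on `M` in which `Pₚ` is the only true predicate (none is, if `p = 0`). -/
@[reducible]
def predStructure (M : Type) (p : ℕ) : sigP.Structure M where
  funMap f := f.elim
  RelMap := fun {_} R _ => match R with
    | .P k => (k : ℕ) = p

theorem model_Teq_iff {M : Type} [sigP.Structure M] [Nonempty M] :
    M ⊨ Teq ↔ ∀ n : ℕ+, Structure.RelMap (symP n) (default : Fin 0 → M) →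
      Cardinal.mk M = (n : ℕ) := by
  simp only [Teq, Theory.model_iff, Set.forall_mem_range, Sentence.Realize, Formula.realize_imp]
  refine forall_congr' fun n => imp_congr ?_ (realize_psiEq _)
  rw [predAtom]
  refine Formula.realize_rel.trans ?_
  rw [Subsingleton.elim (fun i => Term.realize _ _) default]

/-- The parameters are the base, the index of the true predicate and the digits of the valuation. -/
def predTermEval (a : ℕ × ℕ × ℕ) (c : ℕ) : Option ℕ := (varDecode c).map (digit a.1 a.2.2)

/-- The truth value of the predicate coded by `c`. -/
def predRelEval (a : ℕ × ℕ × ℕ) (c : ℕ) : Option Bool :=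
  if c.unpair.1 = 0 ∧ c.unpair.2.unpair.2 = 0 ∧ 0 < c.unpair.2.unpair.1 then
    some (decide (c.unpair.2.unpair.1 = a.2.1))
  else none

theorem primrec_predTermEval : Primrec₂ predTermEval :=
  Primrec.option_map (primrec_varDecode.comp Primrec.snd)
    (primrec_digit.comp (Primrec.pair (Primrec.fst.comp (Primrec.fst.comp Primrec.fst))
      (Primrec.pair (Primrec.snd.comp (Primrec.snd.comp (Primrec.fst.comp Primrec.fst)))
        Primrec.snd)))

theorem primrec_predRelEval : Primrec₂ predRelEval := by
  have hc : Primrec fun p : (ℕ × ℕ × ℕ) × ℕ => p.2.unpair := Primrec.unpair.comp Primrec.snd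
  have hc2 : Primrec fun p : (ℕ × ℕ × ℕ) × ℕ => p.2.unpair.2.unpair :=
    Primrec.unpair.comp (Primrec.snd.comp hc)
  refine Primrec.ite (PrimrecPred.and (Primrec.eq.comp (Primrec.fst.comp hc) (Primrec.const 0))
    (PrimrecPred.and (Primrec.eq.comp (Primrec.snd.comp hc2) (Primrec.const 0))
      (Primrec.nat_lt.comp (Primrec.const 0) (Primrec.fst.comp hc2)))) ?_ (Primrec.const _)
  exact Primrec.option_some.comp (Primrec.eq.decide.comp (Primrec.fst.comp hc2)
    (Primrec.fst.comp (Primrec.snd.comp Primrec.fst)))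

theorem predRelEval_relCode (a : ℕ × ℕ × ℕ) (k : ℕ+) (ts : Fin 0 → sigP.Term (ℕ ⊕ Fin 0)) :
    predRelEval a (relCode (symP k) ts) = some (decide ((k : ℕ) = a.2.1)) := by
  have h : (Encodable.encode (symP k) : ℕ) = k := rfl
  simp [predRelEval, relCode, h]

/-- The counterpart of `lt_termCode_of_var` for predicate indices. -/
theorem le_relCode (k : ℕ+) (ts : Fin 0 → sigP.Term (ℕ ⊕ Fin 0)) :
    (k : ℕ) ≤ relCode (symP k) ts :=
  (Nat.left_le_pair (k : ℕ) _).trans (Nat.right_le_pair 0 _)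

/-- The evaluation agrees with any structure and valuation that have the same pattern of equalities
between variables and the same true predicates, up to the code of the formula. -/
theorem predEval_formulaCode {M : Type} [sigP.Structure M] (w : ℕ → M) (a : ℕ × ℕ × ℕ)
    (φ : sigP.Formula ℕ) (hφ : BoundedFormula.IsQF φ)
    (hw : ∀ i < formulaCode φ, ∀ j < formulaCode φ,
      (digit a.1 a.2.2 i = digit a.1 a.2.2 j ↔ w i = w j))
    (hp : ∀ k : ℕ+, (k : ℕ) < formulaCode φ →
      (Structure.RelMap (symP k) (default : Fin 0 → M) ↔ (k : ℕ) = a.2.1)) :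
    qfEval predTermEval predRelEval a (formulaCode φ) = some true ↔ φ.Realize w := by
  have key := qfEval_formulaCode (tv := predTermEval) (rv := predRelEval) w a (formulaCode φ)
    ?_ ?_ φ hφ le_rfl
  · obtain ⟨b, hb, hb'⟩ := key
    rw [hb, ← hb', Option.some.injEq]
  · rintro ((i | i) | i) ((j | j) | j) hi hj
    · refine ⟨_, _, ?_, ?_, hw i (lt_termCode_of_var.trans_lt hi) j (lt_termCode_of_var.trans_lt hj)⟩
        <;> simp only [predTermEval, varDecode_termCode, Option.map_some]
    all_goals first | exact Fin.elim0 (by assumption) | exact Empty.elim (by assumption)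
  · rintro l (k : PredSym l) ts hc
    obtain ⟨k⟩ := k
    refine ⟨_, predRelEval_relCode a k ts, ?_⟩
    rw [decide_eq_true_iff, ← hp k ((le_relCode k ts).trans_lt hc),
      Subsingleton.elim (fun i => (ts i).realize (Sum.elim w default)) default]
    rfl

/-- Evaluation fails on numbers that are not codes, so the decision procedure needs no separate
syntax check. -/
theorem exists_formulaCode_of_predEval (a : ℕ × ℕ × ℕ) (c : ℕ) (b : Bool)
    (h : qfEval predTermEval predRelEval a c = some b) :
    ∃ φ : sigP.Formula ℕ, BoundedFormula.IsQF φ ∧ formulaCode φ = c := by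
  refine exists_formulaCode_of_qfEval a ?_ ?_ c b h
  · intro c x hx
    obtain ⟨i, hi, -⟩ := Option.map_eq_some_iff.1 hx
    exact ⟨_, termCode_of_varDecode hi⟩
  · intro c b hb
    simp only [predRelEval, Option.ite_none_right_eq_some] at hb
    obtain ⟨⟨h1, h2, h3⟩, -⟩ := hb
    refine ⟨0, symP ⟨_, h3⟩, default, ?_⟩
    have : (Encodable.encode (symP ⟨_, h3⟩) : ℕ) = c.unpair.2.unpair.1 := rfl
    have e₂ := Nat.pair_unpair c.unpair.2
    have e₁ := Nat.pair_unpair c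
    rw [h2] at e₂
    rw [h1] at e₁
    rw [relCode, this, List.ofFn_zero, Encodable.encode_list_nil, e₂, e₁]

/-- The formula coded by `c` is true in a model of `T₌` with `n` elements. -/
def PredSat (n c : ℕ) : Prop :=
  ∃ x < n ^ c,
    qfEval predTermEval predRelEval (n, 0, x) c = some true ∨
    qfEval predTermEval predRelEval (n, n, x) c = some true

theorem primrecRel_predSat : PrimrecRel PredSat := by
  have h : ∀ {f : (ℕ × ℕ) → ℕ}, Primrec f → PrimrecRel fun (p : ℕ × ℕ) (x : ℕ) =>
      qfEval predTermEval predRelEval (p.1, f p, x) p.2 = some true := fun hf =>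
    Primrec.eq.comp ((primrec_qfEval primrec_predTermEval primrec_predRelEval).comp
      (Primrec.pair (Primrec.fst.comp Primrec.fst)
        (Primrec.pair (hf.comp Primrec.fst) Primrec.snd))
      (Primrec.snd.comp Primrec.fst)) (Primrec.const _)
  exact primrecPred_exists_lt (R := fun (p : ℕ × ℕ) x =>
      qfEval predTermEval predRelEval (p.1, 0, x) p.2 = some true ∨
      qfEval predTermEval predRelEval (p.1, p.1, x) p.2 = some true)
    (PrimrecPred.or (h (Primrec.const 0)) (h Primrec.fst))
    (primrec_pow.comp Primrec.fst Primrec.snd)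

/-- In a model with `n` elements only `Pₙ` can hold, so the two alternatives in `PredSat` (no true
predicate, or just `Pₙ`) cover all models. -/
theorem predSat_of_equiv {M : Type} [sigP.Structure M] [M ⊨ Teq] {n : ℕ} (e : M ≃ Fin n)
    (w : ℕ → M) {φ : sigP.Formula ℕ} (hφ : BoundedFormula.IsQF φ) (h : φ.Realize w) :
    PredSat n (formulaCode φ) := by
  obtain ⟨x, hx, hd⟩ := exists_digits (formulaCode φ) (fun i => (e (w i) : ℕ)) fun i _ => (e _).2
  refine ⟨x, hx, ?_⟩
  have hw : ∀ i < formulaCode φ, ∀ j < formulaCode φ,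
      (digit n x i = digit n x j ↔ w i = w j) := fun i hi j hj => by
    rw [hd i hi, hd j hj, ← Fin.ext_iff, e.apply_eq_iff_eq]
  have : Nonempty M := ⟨w 0⟩
  have hT := model_Teq_iff.1 ‹M ⊨ Teq›
  have hcard : Cardinal.mk M = n := by simpa using Cardinal.mk_congr e
  by_cases hP : ∃ k : ℕ+, Structure.RelMap (symP k) (default : Fin 0 → M)
  · obtain ⟨k, hk⟩ := hP
    have hkn : (n : ℕ) = k := by exact_mod_cast hcard.symm.trans (hT k hk)
    refine Or.inr ((predEval_formulaCode w _ φ hφ hw fun k' _ => ⟨fun h' => ?_, fun h' => ?_⟩).2 h)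
    · exact_mod_cast (hT k' h').symm.trans hcard
    · have : k' = k := PNat.eq (by rw [← hkn]; exact h')
      rwa [this]
  · push Not at hP
    exact Or.inl ((predEval_formulaCode w _ φ hφ hw fun k' _ =>
      ⟨fun h' => (hP _ h').elim, fun h' => (k'.ne_zero h').elim⟩).2 h)

theorem predSat_of_le {M : Type} [sigP.Structure M] {w : ℕ → M} {φ : sigP.Formula ℕ}
    (hφ : BoundedFormula.IsQF φ) (h : φ.Realize w)
    (hP : ∀ k : ℕ+, (k : ℕ) < formulaCode φ → ¬ Structure.RelMap (symP k) (default : Fin 0 → M))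
    {n : ℕ} (hn : formulaCode φ ≤ n) : PredSat n (formulaCode φ) := by
  classical
  have hex : ∀ i, ∃ j, w j = w i := fun i => ⟨i, rfl⟩
  -- Each value is represented by the least index at which it occurs. This keeps the equality
  -- pattern and stays below the code of `φ`, hence below `n`.
  obtain ⟨x, hx, hd⟩ := exists_digits (b := n) (formulaCode φ) (fun i => Nat.find (hex i))
    fun i hi => (Nat.find_min' (hex i) rfl).trans_lt (hi.trans_le hn)
  refine ⟨x, hx, Or.inl ((predEval_formulaCode w _ φ hφ ?_ fun k' hk' =>
      ⟨fun h' => (hP _ hk' h').elim, fun h' => (k'.ne_zero h').elim⟩).2 h)⟩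
  intro i hi j hj
  change digit n x i = digit n x j ↔ _
  rw [hd i hi, hd j hj]
  constructor
  · intro e
    rw [← Nat.find_spec (hex i), ← Nat.find_spec (hex j)]
    exact congrArg w e
  · intro e
    simp only [e]

theorem model_predStructure {M : Type} [Nonempty M] {p : ℕ} (h : p = 0 ∨ Cardinal.mk M = p) :
    let := predStructure M p
    M ⊨ Teq := by
  let := predStructure M p
  refine model_Teq_iff.2 fun n hn => ?_
  have hn' : (n : ℕ) = p := hn
  rcases h with rfl | h
  · exact (n.ne_zero hn').elim
  · rw [h, hn']

/-- A formula true in a model with `n` elements, as expressed by `PredSat`, has a model on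
`Fin n`. -/
theorem exists_predStructure {n : ℕ} (hn : 0 < n) {φ : sigP.Formula ℕ}
    (hφ : BoundedFormula.IsQF φ) (h : PredSat n (formulaCode φ)) :
    ∃ p : ℕ, (p = 0 ∨ p = n) ∧ ∃ w : ℕ → Fin n,
      let := predStructure (Fin n) p
      φ.Realize w := by
  obtain ⟨x, -, h⟩ := h
  have key : ∀ p, qfEval predTermEval predRelEval (n, p, x) (formulaCode φ) = some true →
      let := predStructure (Fin n) p
      φ.Realize fun i => (⟨digit n x i, digit_lt hn x i⟩ : Fin n) := by
    intro p hp
    let := predStructure (Fin n) p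
    refine (predEval_formulaCode _ (n, p, x) φ hφ (fun i _ j _ => ?_) fun k _ => Iff.rfl).1 hp
    rw [Fin.mk.injEq]
  rcases h with h | h
  · exact ⟨0, Or.inl rfl, _, key _ h⟩
  · exact ⟨n, Or.inr rfl, _, key _ h⟩

/-- Beyond the code of `φ`, the only predicate that can hold is one that `φ` does not mention, and
there is room for every equality pattern of its variables. -/
theorem predSat_iff_of_le {φ : sigP.Formula ℕ} (hφ : BoundedFormula.IsQF φ) {n m : ℕ}
    (hn : formulaCode φ < n) (hm : formulaCode φ < m) :
    PredSat n (formulaCode φ) ↔ PredSat m (formulaCode φ) := by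
  suffices H : ∀ {n m : ℕ}, formulaCode φ < n → formulaCode φ < m →
      PredSat n (formulaCode φ) → PredSat m (formulaCode φ) from ⟨H hn hm, H hm hn⟩
  intro n m hn hm h
  obtain ⟨p, hp, w, hw⟩ := exists_predStructure (by omega) hφ h
  let := predStructure (Fin n) p
  refine predSat_of_le hφ hw (fun k hk hk' => ?_) hm.le
  have : (k : ℕ) = p := hk'
  have := k.pos
  omega

theorem natCast_mem_Spec_Teq {φ : sigP.Formula ℕ} (hφ : BoundedFormula.IsQF φ) {n : ℕ}
    (hn : 0 < n) : (n : Cardinal.{0}) ∈ Spec Teq φ ↔ PredSat n (formulaCode φ) := by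
  constructor
  · rintro ⟨-, M, w, hw, hM⟩
    have hM' : Cardinal.mk M = Cardinal.mk (Fin n) := by rw [hM, Cardinal.mk_fin]
    obtain ⟨e⟩ := Cardinal.eq.1 hM'
    exact predSat_of_equiv e w hφ hw
  · intro h
    obtain ⟨p, hp, w, hw⟩ := exists_predStructure hn hφ h
    let := predStructure (Fin n) p
    have : Nonempty (Fin n) := ⟨⟨0, hn⟩⟩
    have : Fin n ⊨ Teq := model_predStructure (by rw [Cardinal.mk_fin, Nat.cast_inj]; tauto)
    exact ⟨Cardinal.natCast_le_aleph0, Theory.ModelType.of Teq (Fin n), w, hw, Cardinal.mk_fin n⟩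

/-- Every predicate is false in an infinite model, because each forces a finite size. -/
theorem predSat_of_infinite {M : Type} [sigP.Structure M] [M ⊨ Teq] [Infinite M]
    {w : ℕ → M} {φ : sigP.Formula ℕ} (hφ : BoundedFormula.IsQF φ) (h : φ.Realize w)
    {n : ℕ} (hn : formulaCode φ ≤ n) : PredSat n (formulaCode φ) := by
  refine predSat_of_le hφ h (fun k _ hk => ?_) hn
  exact (Cardinal.aleph0_le_mk M).not_gt
    (by rw [model_Teq_iff.1 ‹M ⊨ Teq› k hk]; exact Cardinal.natCast_lt_aleph0)

theorem aleph0_mem_Spec_Teq {φ : sigP.Formula ℕ} (hφ : BoundedFormula.IsQF φ) :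
    Cardinal.aleph0.{0} ∈ Spec Teq φ ↔ PredSat (formulaCode φ + 1) (formulaCode φ) := by
  constructor
  · rintro ⟨-, M, w, hw, hM⟩
    have : Infinite M := Cardinal.infinite_iff.2 hM.ge
    exact predSat_of_infinite hφ hw (Nat.le_succ _)
  · intro h
    obtain ⟨p, hp, w, hw⟩ := exists_predStructure (Nat.succ_pos _) hφ h
    let := predStructure (Fin (formulaCode φ + 1)) p
    let := predStructure ℕ 0
    have : ℕ ⊨ Teq := model_predStructure (Or.inl rfl)
    obtain ⟨x, -, hd⟩ := exists_digits (b := formulaCode φ + 1) (formulaCode φ)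
      (fun i => (w i : ℕ)) fun i _ => (w i).2
    refine ⟨le_rfl, Theory.ModelType.of Teq ℕ, fun i => (w i : ℕ), ?_, Cardinal.mk_nat⟩
    -- The valuation is copied from `Fin (formulaCode φ + 1)` to `ℕ`. Both structures agree with the
    -- same evaluation, since the index `p` is `0` or exceeds the code of `φ`.
    refine (predEval_formulaCode (M := ℕ) (fun i => (w i : ℕ)) (formulaCode φ + 1, 0, x) φ hφ
      (fun i hi j hj => by simp only [hd i hi, hd j hj]) fun k _ => Iff.rfl).1 ?_
    refine (predEval_formulaCode w (formulaCode φ + 1, 0, x) φ hφ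
      (fun i hi j hj => by simp only [hd i hi, hd j hj, Fin.ext_iff]) fun k hk => ?_).2 hw
    change (k : ℕ) = p ↔ (k : ℕ) = 0
    have := k.pos
    omega

theorem exists_formulaCode_of_predSat {n c : ℕ} (h : PredSat n c) :
    ∃ φ : sigP.Formula ℕ, BoundedFormula.IsQF φ ∧ formulaCode φ = c := by
  obtain ⟨x, -, h | h⟩ := h <;> exact exists_formulaCode_of_predEval _ _ _ h

theorem decidableTheory_Teq : DecidableTheory Teq := by
  -- The sizes tested are `1, …, c + 1`; the last stands for all larger sizes and for infinite
  -- models.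
  have h : PrimrecPred fun c => ∃ n < c + 1, PredSat (n + 1) c :=
    primrecPred_exists_lt (R := fun c n => PredSat (n + 1) c)
      (primrecRel_predSat.comp (Primrec.succ.comp Primrec.snd) Primrec.fst) Primrec.succ
  refine h.computablePred.of_eq fun c => ⟨?_, ?_⟩
  · rintro ⟨n, -, h⟩
    obtain ⟨φ, hφ, rfl⟩ := exists_formulaCode_of_predSat h
    obtain ⟨-, M, w, hw, -⟩ := (natCast_mem_Spec_Teq hφ n.succ_pos).2 h
    exact ⟨φ, hφ, ⟨M, w, hw⟩, rfl⟩
  · rintro ⟨φ, hφ, ⟨M, w, hw⟩, rfl⟩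
    rcases finite_or_infinite M with hM | hM
    · obtain ⟨n, ⟨e⟩⟩ := Finite.exists_equiv_fin M
      have hs := predSat_of_equiv e w hφ hw
      have hn : 0 < n := (e (w 0)).pos
      rcases lt_or_ge (formulaCode φ) n with h | h
      · exact ⟨formulaCode φ, by omega, (predSat_iff_of_le hφ h (Nat.lt_succ_self _)).1 hs⟩
      · exact ⟨n - 1, by omega, by rwa [Nat.sub_add_cancel hn]⟩
    · exact ⟨formulaCode φ, by omega, predSat_of_infinite hφ hw (Nat.le_succ _)⟩

theorem IsCube.isQF {L : FirstOrder.Language.{0, 0}} {φ : L.Formula ℕ} (h : IsCube φ) :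
    BoundedFormula.IsQF φ := by
  induction h with
  | top => exact BoundedFormula.IsQF.top
  | lit h =>
    rcases h with h | h
    · exact h.isQF
    · exact h.isQF.not
  | and _ _ h₁ h₂ => exact h₁.inf h₂

/-- Size `c + 1` decides between a finite and a cofinite spectrum; `S` collects the smaller sizes
whose answer differs from that one. -/
theorem gentle_Teq : Gentle Teq := by
  classical
  let b : ℕ → Bool := fun c => decide (¬ PredSat (c + 1) c)
  let S : ℕ → List ℕ := fun c => ((List.range (c + 1)).map Nat.succ).filter fun n =>
    decide (PredSat n c ↔ ¬ PredSat (c + 1) c)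
  have hsat : PrimrecPred fun c => PredSat (c + 1) c :=
    primrecRel_predSat.comp Primrec.succ Primrec.id
  have hb : Primrec b := hsat.not.decide
  have hSp : Primrec S := by
    have hR : PrimrecRel fun n c => (PredSat n c ↔ ¬ PredSat (c + 1) c) := by
      refine PrimrecPred.of_eq
        (Primrec.eq.comp primrecRel_predSat.decide (hb.comp Primrec.snd)) fun p => ?_
      by_cases h₁ : PredSat p.1 p.2 <;> by_cases h₂ : PredSat (p.2 + 1) p.2 <;> simp [b, h₁, h₂]
    refine Primrec.of_eq (hR.listFilter.comp
      (Primrec.list_map (Primrec.list_range.comp Primrec.succ) (Primrec.succ.comp Primrec.snd).to₂)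
      Primrec.id) fun c => ?_
    simp only [S, id]
  have hmem : ∀ c n, n ∈ S c ↔ 0 < n ∧ n ≤ c + 1 ∧ (PredSat n c ↔ ¬ PredSat (c + 1) c) := by
    intro c n
    simp only [S, List.mem_filter, List.mem_map, List.mem_range, decide_eq_true_iff]
    constructor
    · rintro ⟨⟨m, hm, rfl⟩, h⟩
      exact ⟨m.succ_pos, hm, h⟩
    · rintro ⟨h1, h2, h3⟩
      exact ⟨⟨n - 1, by omega, by omega⟩, h3⟩
  refine ⟨fun c => (b c, S c), (hb.pair hSp).to_comp, fun φ hφ => ⟨?_, ?_, ?_⟩⟩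
  · intro n hn
    exact ((hmem _ _).1 hn).1
  · intro hbt
    have hbt : ¬ PredSat (formulaCode φ + 1) (formulaCode φ) := of_decide_eq_true hbt
    refine Set.ext fun κ => ⟨fun hκ => ?_, ?_⟩
    · rcases hκ.1.lt_or_eq with hlt | rfl
      · obtain ⟨n, rfl⟩ := Cardinal.lt_aleph0.1 hlt
        have hn : 0 < n := by
          obtain ⟨-, M, w, -, hM⟩ := hκ
          have : Cardinal.mk M ≠ 0 := Cardinal.mk_ne_zero_iff.2 ⟨w 0⟩
          rw [hM] at this
          exact Nat.pos_of_ne_zero (by exact_mod_cast this)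
        have hs := (natCast_mem_Spec_Teq hφ.isQF hn).1 hκ
        refine ⟨n, (hmem _ _).2 ⟨hn, ?_, iff_of_true hs hbt⟩, rfl⟩
        by_contra hlt
        exact hbt ((predSat_iff_of_le hφ.isQF (by omega) (Nat.lt_succ_self _)).1 hs)
      · exact (hbt ((aleph0_mem_Spec_Teq hφ.isQF).1 hκ)).elim
    · rintro ⟨n, hn, rfl⟩
      obtain ⟨h1, -, h3⟩ := (hmem _ _).1 hn
      exact (natCast_mem_Spec_Teq hφ.isQF h1).2 (h3.2 hbt)
  · intro hbf
    have hbf : PredSat (formulaCode φ + 1) (formulaCode φ) :=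
      not_not.1 (of_decide_eq_false hbf)
    refine Set.ext fun κ => ⟨fun hκ => ⟨⟨?_, hκ.1⟩, ?_⟩, ?_⟩
    · obtain ⟨-, M, w, -, rfl⟩ := hκ
      exact Cardinal.one_le_iff_ne_zero.2 (Cardinal.mk_ne_zero_iff.2 ⟨w 0⟩)
    · rintro ⟨n, hn, rfl⟩
      obtain ⟨h1, -, h3⟩ := (hmem _ _).1 hn
      exact h3.1 ((natCast_mem_Spec_Teq hφ.isQF h1).1 hκ) hbf
    · rintro ⟨⟨h1, h2⟩, hκ⟩
      rcases h2.lt_or_eq with hlt | rfl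
      · obtain ⟨n, rfl⟩ := Cardinal.lt_aleph0.1 hlt
        have hn : 0 < n := by exact_mod_cast h1
        refine (natCast_mem_Spec_Teq hφ.isQF hn).2 ?_
        by_contra hs
        rcases lt_or_ge (formulaCode φ + 1) n with h | h
        · exact hs ((predSat_iff_of_le hφ.isQF (by omega) (Nat.lt_succ_self _)).2 hbf)
        · exact hκ ⟨n, (hmem _ _).2 ⟨hn, h, iff_of_false hs (not_not.2 hbf)⟩, rfl⟩
      · exact (aleph0_mem_Spec_Teq hφ.isQF).2 hbf

/-! ### The theory `T_f` -/

/-- The structure on `M` in which `s` is interpreted by `g`. -/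
@[reducible]
def funStructure {M : Type} (g : M → M) : sigS.Structure M where
  funMap := fun {_} F => match F with
    | .s => fun xs => g (xs 0)
  RelMap R := R.elim

/-- The interpretation of `s`. -/
def interpS (M : Type) [sigS.Structure M] (x : M) : M := Structure.funMap symS fun _ => x

/-- The set of fixed points of `s`. -/
def fixedSet (M : Type) [sigS.Structure M] : Set M := {x | interpS M x = x}

section Realize

variable {M : Type} [sigS.Structure M]

theorem realize_distinctF {n : ℕ} {v : Empty → M} {xs : Fin n → M} :
    (distinctF n).Realize v xs ↔ Function.Injective xs := by
  simp only [distinctF, BoundedFormula.realize_iInf, BoundedFormula.realize_not,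
    BoundedFormula.realize_bdEqual, Term.realize_var, Sum.elim_inr, Function.comp_apply,
    Subtype.forall, Prod.forall]
  constructor
  · intro h i j hij
    by_contra hne
    rcases lt_or_gt_of_ne hne with hlt | hlt
    · exact h i j hlt hij
    · exact h j i hlt hij.symm
  · intro h i j hij hx
    exact hij.ne (h hx)

variable {q : ∀ {m : ℕ}, sigS.Term (Empty ⊕ Fin m) → sigS.BoundedFormula Empty m} {Q : Set M}

theorem realize_atLeastF
    (hq : ∀ {m : ℕ} (t : sigS.Term (Empty ⊕ Fin m)) (v : Empty → M) (xs : Fin m → M),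
      (q t).Realize v xs ↔ t.realize (Sum.elim v xs) ∈ Q) (n : ℕ) :
    M ⊨ atLeastF q n ↔ (n : ℕ∞) ≤ Q.encard := by
  rw [atLeastF, Sentence.Realize, BoundedFormula.realize_exs]
  simp only [BoundedFormula.realize_inf, realize_distinctF, BoundedFormula.realize_iInf, hq,
    Term.realize_var, Sum.elim_inr, Function.comp_apply]
  constructor
  · rintro ⟨xs, hi, hx⟩
    have h : (Set.range xs).encard = n := by
      rw [← Set.image_univ, hi.encard_image, Set.encard_univ, ENat.card_eq_coe_fintype_card,
        Fintype.card_fin]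
    rw [← h]
    exact Set.encard_le_encard (Set.range_subset_iff.2 hx)
  · intro h
    obtain ⟨t, ht, htn⟩ := Set.exists_subset_encard_eq h
    have htf : t.Finite := Set.finite_of_encard_eq_coe htn
    have : Finite t := htf
    have hc : Nat.card t = n := by
      rw [Nat.card_coe_set_eq, Set.ncard, htn, ENat.toNat_natCast]
    let e := (Finite.equivFinOfCardEq hc).symm
    exact ⟨fun i => e i, Subtype.val_injective.comp e.injective, fun i => ht (e i).2⟩

theorem realize_exactlyF
    (hq : ∀ {m : ℕ} (t : sigS.Term (Empty ⊕ Fin m)) (v : Empty → M) (xs : Fin m → M),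
      (q t).Realize v xs ↔ t.realize (Sum.elim v xs) ∈ Q) (n : ℕ) :
    M ⊨ exactlyF q n ↔ Q.encard = n := by
  rw [exactlyF, Sentence.Realize, BoundedFormula.realize_exs]
  simp only [BoundedFormula.realize_inf, realize_distinctF, BoundedFormula.realize_iInf, hq,
    Term.realize_var, Sum.elim_inr, Function.comp_apply, BoundedFormula.realize_all,
    BoundedFormula.realize_imp, BoundedFormula.realize_iSup, BoundedFormula.realize_bdEqual,
    Fin.snoc_last, Fin.snoc_castSucc]
  constructor
  · rintro ⟨xs, ⟨hi, hx⟩, hs⟩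
    have h : (Set.range xs).encard = n := by
      rw [← Set.image_univ, hi.encard_image, Set.encard_univ, ENat.card_eq_coe_fintype_card,
        Fintype.card_fin]
    rw [← h]
    congr 1
    refine Set.Subset.antisymm (fun a ha => ?_) (Set.range_subset_iff.2 hx)
    obtain ⟨i, hi⟩ := hs a ha
    exact ⟨i, hi.symm⟩
  · intro h
    have : Finite Q := Set.finite_of_encard_eq_coe h
    have hc : Nat.card Q = n := by
      rw [Nat.card_coe_set_eq, Set.ncard, h, ENat.toNat_natCast]
    let e := (Finite.equivFinOfCardEq hc).symm
    refine ⟨fun i => e i, ⟨Subtype.val_injective.comp e.injective, fun i => (e i).2⟩,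
      fun a ha => ⟨e.symm ⟨a, ha⟩, ?_⟩⟩
    simp

theorem realize_fixF {m : ℕ} (t : sigS.Term (Empty ⊕ Fin m)) (v : Empty → M) (xs : Fin m → M) :
    (fixF t).Realize v xs ↔ t.realize (Sum.elim v xs) ∈ fixedSet M := by
  rw [fixF, BoundedFormula.realize_bdEqual, Functions.apply₁, Term.realize_func]
  have : (fun i => (![t] i).realize (Sum.elim v xs)) = fun _ => t.realize (Sum.elim v xs) := by
    funext i
    rw [Subsingleton.elim i 0]
    rfl
  rw [this]
  rfl

theorem realize_nonfixF {m : ℕ} (t : sigS.Term (Empty ⊕ Fin m)) (v : Empty → M)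
    (xs : Fin m → M) :
    (nonfixF t).Realize v xs ↔ t.realize (Sum.elim v xs) ∈ (fixedSet M)ᶜ := by
  rw [nonfixF, BoundedFormula.realize_not, realize_fixF, Set.mem_compl_iff]

/-- Whether a structure satisfies `T_f` depends only on the numbers of its fixed and non-fixed
points. -/
theorem model_Tf_iff (f : ℕ+ → Fin 2) :
    M ⊨ Tf f ↔ ∀ k : ℕ+,
      ((countVal f 1 k : ℕ∞) ≤ (fixedSet M).encard ∧
        (countVal f 0 k : ℕ∞) ≤ (fixedSet M)ᶜ.encard) ∨
      ∃ i ≤ k, (fixedSet M).encard = countVal f 1 i ∧ (fixedSet M)ᶜ.encard = countVal f 0 i := by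
  have inf : ∀ φ ψ : sigS.Sentence, M ⊨ φ ⊓ ψ ↔ M ⊨ φ ∧ M ⊨ ψ := fun φ ψ => by
    simp only [Sentence.Realize, Formula.realize_inf]
  have sup : ∀ φ ψ : sigS.Sentence, M ⊨ φ ⊔ ψ ↔ M ⊨ φ ∨ M ⊨ ψ := fun φ ψ => by
    simp only [Sentence.Realize, Formula.realize_sup]
  have iSup : ∀ (k : ℕ+) (g : Finset.Icc (1 : ℕ+) k → sigS.Sentence),
      M ⊨ Formula.iSup g ↔ ∃ i, M ⊨ g i := fun k g => by
    simp only [Sentence.Realize, Formula.realize_iSup]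
  simp only [Tf, Theory.model_iff, Set.forall_mem_range]
  refine forall_congr' fun k => ?_
  rw [sup, inf, iSup]
  simp only [inf, realize_atLeastF realize_fixF, realize_atLeastF realize_nonfixF,
    realize_exactlyF realize_fixF, realize_exactlyF realize_nonfixF, Subtype.exists,
    Finset.mem_Icc, one_le, true_and, exists_prop]

end Realize

/-! ### Evaluation of terms in the signature with one unary function symbol -/

/-- The code of `t`, if `c` is the code of `s(t)`. -/
def argCode (c : ℕ) : ℕ := (c.unpair.2.unpair.2.unpair.2 - 1).unpair.1

/-- The code of `s(t)` if `c` is the code of `t`. -/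
def appCode (c : ℕ) : ℕ := Nat.pair 1 (Nat.pair 1 (Nat.pair 0 (Nat.pair c 0 + 1)))

theorem argCode_appCode (c : ℕ) : argCode (appCode c) = c := by
  simp [argCode, appCode]

theorem lt_appCode (c : ℕ) : c < appCode c := by
  have h1 := Nat.left_le_pair c 0
  have h2 := Nat.right_le_pair 0 (Nat.pair c 0 + 1)
  have h3 := Nat.right_le_pair 1 (Nat.pair 0 (Nat.pair c 0 + 1))
  have h4 := Nat.right_le_pair 1 (Nat.pair 1 (Nat.pair 0 (Nat.pair c 0 + 1)))
  rw [appCode]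
  omega

/-- The argument list has one entry, and a nonempty list is encoded as a successor: hence the `+ 1`
in `appCode` and the `- 1` in `argCode`. -/
theorem termCode_apply₁ (t : sigS.Term (ℕ ⊕ Fin 0)) :
    termCode (symS.apply₁ t) = appCode (termCode t) := by
  have h : (Encodable.encode symS : ℕ) = 0 := rfl
  simp [Functions.apply₁, termCode, appCode, h, List.ofFn_succ]

theorem term_induction {motive : sigS.Term (ℕ ⊕ Fin 0) → Prop}
    (var : ∀ i, motive (Term.var (Sum.inl i)))
    (app : ∀ t, motive t → motive (symS.apply₁ t)) (t : sigS.Term (ℕ ⊕ Fin 0)) : motive t := by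
  induction t with
  | var i =>
    rcases i with i | i
    · exact var i
    · exact i.elim0
  | @func l F ts ih =>
    cases F
    have : Term.func symS ts = symS.apply₁ (ts 0) := by
      rw [Functions.apply₁]
      congr 1
      funext i
      rw [Subsingleton.elim i 0]
      rfl
    exact this ▸ app _ (ih 0)

theorem appCode_ne_var (c i : ℕ) :
    appCode c ≠ termCode (Term.var (Sum.inl i) : sigS.Term (ℕ ⊕ Fin 0)) := fun h => by
  have := congrArg (fun c => c.unpair.1) h
  simp [appCode, termCode] at this

/-- The parameters are the base, the digits of the interpretation of `s` and the digits of the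
valuation. -/
def funTermEval (a : ℕ × ℕ × ℕ) (c : ℕ) : Option ℕ :=
  if _h : c = appCode (argCode c) then (funTermEval a (argCode c)).map (digit a.1 a.2.1)
  else (varDecode c).map (digit a.1 a.2.2)
termination_by c
decreasing_by
  conv_rhs => rw [_h]
  exact lt_appCode _

/-- `argCode` is total, so `funTermEval` recognizes an application by re-encoding its supposed
argument. -/
theorem funTermEval_appCode (a : ℕ × ℕ × ℕ) (c : ℕ) :
    funTermEval a (appCode c) = (funTermEval a c).map (digit a.1 a.2.1) := by
  rw [funTermEval, dif_pos (by rw [argCode_appCode]), argCode_appCode]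

theorem funTermEval_var (a : ℕ × ℕ × ℕ) (i : ℕ) :
    funTermEval a (termCode (Term.var (Sum.inl i) : sigS.Term (ℕ ⊕ Fin 0))) =
      some (digit a.1 a.2.2 i) := by
  rw [funTermEval, dif_neg fun h => appCode_ne_var _ _ h.symm, varDecode_termCode, Option.map_some]

theorem primrec_argCode : Primrec argCode :=
  Primrec.fst.comp (Primrec.unpair.comp (Primrec.nat_sub.comp
    (Primrec.snd.comp (Primrec.unpair.comp (Primrec.snd.comp (Primrec.unpair.comp
      (Primrec.snd.comp Primrec.unpair))))) (Primrec.const 1)))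

theorem primrec_appCode : Primrec appCode :=
  Primrec₂.natPair.comp (Primrec.const 1) (Primrec₂.natPair.comp (Primrec.const 1)
    (Primrec₂.natPair.comp (Primrec.const 0)
      (Primrec.succ.comp (Primrec₂.natPair.comp Primrec.id (Primrec.const 0)))))

theorem primrec_funTermEval : Primrec₂ funTermEval := by
  let g : ℕ × ℕ × ℕ → List (Option ℕ) → Option (Option ℕ) := fun a l =>
    some (if l.length = appCode (argCode l.length) then
      (l.getD (argCode l.length) none).map (digit a.1 a.2.1)
    else (varDecode l.length).map (digit a.1 a.2.2))
  refine Primrec.nat_strong_rec (g := g) funTermEval ?_ ?_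
  · have hc : Primrec fun p : (ℕ × ℕ × ℕ) × List (Option ℕ) => p.2.length :=
      Primrec.list_length.comp Primrec.snd
    have hd : ∀ {h : ℕ × ℕ × ℕ → ℕ}, Primrec h →
        Primrec₂ fun (p : (ℕ × ℕ × ℕ) × List (Option ℕ)) i => digit p.1.1 (h p.1) i :=
      fun hh => primrec_digit.comp (Primrec.pair (Primrec.fst.comp (Primrec.fst.comp Primrec.fst))
        (Primrec.pair (hh.comp (Primrec.fst.comp Primrec.fst)) Primrec.snd))
    have ha : Primrec fun p : (ℕ × ℕ × ℕ) × List (Option ℕ) => argCode p.2.length :=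
      primrec_argCode.comp hc
    have hl : Primrec fun p : (ℕ × ℕ × ℕ) × List (Option ℕ) =>
        p.2.getD (argCode p.2.length) none :=
      (Primrec.list_getD (α := Option ℕ) none).comp Primrec.snd ha
    have h1 : Primrec fun p : (ℕ × ℕ × ℕ) × List (Option ℕ) =>
        (p.2.getD (argCode p.2.length) none).map (digit p.1.1 p.1.2.1) :=
      Primrec.option_map hl (hd (h := fun a => a.2.1) (Primrec.fst.comp Primrec.snd))
    have h2 : Primrec fun p : (ℕ × ℕ × ℕ) × List (Option ℕ) =>
        (varDecode p.2.length).map (digit p.1.1 p.1.2.2) :=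
      Primrec.option_map (primrec_varDecode.comp hc) (hd (h := fun a => a.2.2) (Primrec.snd.comp Primrec.snd))
    have h0 : PrimrecPred fun p : (ℕ × ℕ × ℕ) × List (Option ℕ) =>
        p.2.length = appCode (argCode p.2.length) :=
      Primrec.eq.comp hc (primrec_appCode.comp ha)
    exact Primrec.option_some.comp (Primrec.ite h0 h1 h2)
  · intro a n
    rw [funTermEval]
    by_cases h : n = appCode (argCode n)
    · have hlt : argCode n < n := by
        conv_rhs => rw [h]
        exact lt_appCode _
      simp [g, ← h, List.getD, hlt]
    · simp [g, h]

theorem exists_termCode_of_funTermEval (a : ℕ × ℕ × ℕ) (c x : ℕ) (h : funTermEval a c = some x) :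
    ∃ t : sigS.Term (ℕ ⊕ Fin 0), termCode t = c := by
  induction c using Nat.strong_induction_on generalizing x with
  | _ c ih =>
    rw [funTermEval] at h
    split_ifs at h with hc
    · obtain ⟨y, hy, -⟩ := Option.map_eq_some_iff.1 h
      obtain ⟨t, ht⟩ := ih _ (by conv_rhs => rw [hc]
                                 exact lt_appCode _) _ hy
      exact ⟨symS.apply₁ t, by rw [termCode_apply₁, ht, ← hc]⟩
    · obtain ⟨i, hi, -⟩ := Option.map_eq_some_iff.1 h
      exact ⟨_, termCode_of_varDecode hi⟩

theorem realize_apply₁ {M : Type} [sigS.Structure M] {α : Type} (t : sigS.Term α) (v : α → M) :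
    (symS.apply₁ t).realize v = interpS M (t.realize v) := by
  rw [Functions.apply₁, Term.realize_func, interpS]
  congr 1
  funext i
  rw [Subsingleton.elim i 0]
  rfl

/-- `e` labels the elements of `M` by numbers. The digits need to match `s` only at the values of
terms with small codes, so an infinite `M` is allowed. -/
theorem funTermEval_termCode {M : Type} [sigS.Structure M] (w : ℕ → M) (e : M → ℕ)
    (a : ℕ × ℕ × ℕ) (K : ℕ) (hw : ∀ i < K, digit a.1 a.2.2 i = e (w i))
    (hs : ∀ t : sigS.Term (ℕ ⊕ Fin 0), termCode t < K →
      digit a.1 a.2.1 (e (t.realize (Sum.elim w default))) =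
        e (interpS M (t.realize (Sum.elim w default))))
    (t : sigS.Term (ℕ ⊕ Fin 0)) (ht : termCode t < K) :
    funTermEval a (termCode t) = some (e (t.realize (Sum.elim w default))) := by
  induction t using term_induction with
  | var i =>
    rw [funTermEval_var, hw i (lt_termCode_of_var.trans_lt ht)]
    rfl
  | app t ih =>
    rw [termCode_apply₁] at ht ⊢
    have hlt := (lt_appCode _).trans ht
    rw [funTermEval_appCode, ih hlt, Option.map_some, hs t hlt, realize_apply₁]

/-- There are no atoms other than equations. -/
def noRelEval (_ : ℕ × ℕ × ℕ) (_ : ℕ) : Option Bool := none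

theorem funEval_formulaCode {M : Type} [sigS.Structure M] (w : ℕ → M) (e : M → ℕ)
    (a : ℕ × ℕ × ℕ) (φ : sigS.Formula ℕ) (hφ : BoundedFormula.IsQF φ)
    (he : ∀ t t' : sigS.Term (ℕ ⊕ Fin 0), termCode t < formulaCode φ →
      termCode t' < formulaCode φ →
      e (t.realize (Sum.elim w default)) = e (t'.realize (Sum.elim w default)) →
      t.realize (Sum.elim w default) = t'.realize (Sum.elim w (default : Fin 0 → M)))
    (hw : ∀ i < formulaCode φ, digit a.1 a.2.2 i = e (w i))
    (hs : ∀ t : sigS.Term (ℕ ⊕ Fin 0), termCode t < formulaCode φ →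
      digit a.1 a.2.1 (e (t.realize (Sum.elim w default))) =
        e (interpS M (t.realize (Sum.elim w default)))) :
    qfEval funTermEval noRelEval a (formulaCode φ) = some true ↔ φ.Realize w := by
  have key := qfEval_formulaCode (tv := funTermEval) (rv := noRelEval) w a (formulaCode φ)
    (fun t t' ht ht' => ⟨_, _, funTermEval_termCode w e a _ hw hs t ht,
      funTermEval_termCode w e a _ hw hs t' ht', he t t' ht ht', fun h => congrArg e h⟩)
    (fun R => R.elim) φ hφ le_rfl
  obtain ⟨b, hb, hb'⟩ := key
  rw [hb, ← hb', Option.some.injEq]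

/-- The formula coded by `c` is true in a structure with at most `c + 1` elements. -/
def FunSat (c : ℕ) : Prop :=
  ∃ x < (c + 1) ^ (c + 1), ∃ y < (c + 1) ^ (c + 1),
    qfEval funTermEval noRelEval (c + 1, x, y) c = some true

theorem primrecPred_funSat : PrimrecPred FunSat := by
  have hb : Primrec fun c : ℕ => (c + 1) ^ (c + 1) := primrec_pow.comp Primrec.succ Primrec.succ
  refine primrecPred_exists_lt (R := fun c x => ∃ y < (c + 1) ^ (c + 1),
    qfEval funTermEval noRelEval (c + 1, x, y) c = some true) ?_ hb
  refine primrecPred_exists_lt (R := fun (p : ℕ × ℕ) y =>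
    qfEval funTermEval noRelEval (p.1 + 1, p.2, y) p.1 = some true) ?_ (hb.comp Primrec.fst)
  have hc : Primrec fun q : (ℕ × ℕ) × ℕ => q.1.1 := Primrec.fst.comp Primrec.fst
  exact Primrec.eq.comp ((primrec_qfEval (rv := noRelEval) primrec_funTermEval (Primrec₂.const _)).comp
    (Primrec.pair (Primrec.succ.comp hc)
      (Primrec.pair (Primrec.snd.comp Primrec.fst) Primrec.snd)) hc) (Primrec.const _)

/-- Small model property: the truth of `φ` involves only the values of terms with code below that of
`φ`, and such a value can be labelled by the least code of a term denoting it. -/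
theorem funSat_of_realize {M : Type} [sigS.Structure M] {w : ℕ → M} {φ : sigS.Formula ℕ}
    (hφ : BoundedFormula.IsQF φ) (h : φ.Realize w) : FunSat (formulaCode φ) := by
  classical
  let val : sigS.Term (ℕ ⊕ Fin 0) → M := fun t => t.realize (Sum.elim w default)
  let p : M → ℕ → Prop := fun x c => c < formulaCode φ ∧ ∃ t, termCode t = c ∧ val t = x
  -- Elements not named by a small term get the label `0`. A clash with a genuine label is harmless,
  -- as only named elements are compared.
  let e : M → ℕ := fun x => if hx : ∃ c, p x c then Nat.find hx else 0
  -- From a label back to an element; `w 0` is a default for numbers that are not term codes.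
  let arg : ℕ → M := fun c =>
    if hc : ∃ t : sigS.Term (ℕ ⊕ Fin 0), termCode t = c then val hc.choose else w 0
  have he : ∀ t, termCode t < formulaCode φ → ∃ t', termCode t' = e (val t) ∧ val t' = val t := by
    intro t ht
    have hex : ∃ c, p (val t) c := ⟨_, ht, t, rfl, rfl⟩
    simpa only [e, dif_pos hex] using (Nat.find_spec hex).2
  have hlt : ∀ x, e x < formulaCode φ + 1 := fun x => by
    by_cases hex : ∃ c, p x c
    · simpa only [e, dif_pos hex] using (Nat.find_spec hex).1.trans (Nat.lt_succ_self _)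
    · simp only [e, dif_neg hex, Nat.succ_pos]
  have harg : ∀ t : sigS.Term (ℕ ⊕ Fin 0), arg (termCode t) = val t := fun t => by
    have hex : ∃ t' : sigS.Term (ℕ ⊕ Fin 0), termCode t' = termCode t := ⟨t, rfl⟩
    simp only [arg, dif_pos hex, termCode_injective hex.choose_spec]
  obtain ⟨x, hx, hdx⟩ := exists_digits (formulaCode φ + 1) (fun c => e (interpS M (arg c)))
    fun _ _ => hlt _
  obtain ⟨y, hy, hdy⟩ := exists_digits (formulaCode φ + 1) (fun i => e (w i)) fun _ _ => hlt _
  refine ⟨x, hx, y, hy, (funEval_formulaCode w e _ φ hφ ?_ ?_ ?_).2 h⟩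
  · intro t t' ht ht' heq
    obtain ⟨t₁, h₁, h₁'⟩ := he t ht
    obtain ⟨t₂, h₂, h₂'⟩ := he t' ht'
    have : t₁ = t₂ := termCode_injective (h₁.trans (heq.trans h₂.symm))
    exact h₁'.symm.trans ((congrArg val this).trans h₂')
  · exact fun i hi => hdy i (by omega)
  · intro t ht
    obtain ⟨t₁, h₁, h₁'⟩ := he t ht
    refine (hdx _ (hlt _)).trans ?_
    change e (interpS M (arg (e (val t)))) = e (interpS M (val t))
    rw [← h₁, harg, h₁']

/-- A structure on `ℕ` with infinitely many fixed points and infinitely many other points, in which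
`s` agrees with `digit b x` below `b`. -/
def extendDigits (b x n : ℕ) : ℕ :=
  if n < b then digit b x n else if n % 2 = 0 then n else n + 1

theorem model_Tf_extendDigits (f : ℕ+ → Fin 2) (b x : ℕ) :
    letI := funStructure (extendDigits b x)
    ℕ ⊨ Tf f := by
  let := funStructure (extendDigits b x)
  have hfix : (fixedSet ℕ).encard = ⊤ := by
    rw [Set.encard_eq_top_iff]
    refine Set.infinite_of_forall_exists_gt fun n => ⟨2 * (n + b + 1), ?_, by omega⟩
    change extendDigits b x (2 * (n + b + 1)) = 2 * (n + b + 1)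
    rw [extendDigits, if_neg (by omega), if_pos (by omega)]
  have hnon : (fixedSet ℕ)ᶜ.encard = ⊤ := by
    rw [Set.encard_eq_top_iff]
    refine Set.infinite_of_forall_exists_gt fun n => ⟨2 * (n + b + 1) + 1, ?_, by omega⟩
    change ¬ extendDigits b x (2 * (n + b + 1) + 1) = 2 * (n + b + 1) + 1
    rw [extendDigits, if_neg (by omega), if_neg (by omega)]
    omega
  refine (model_Tf_iff f).2 fun k => Or.inl ?_
  rw [hfix, hnon]
  exact ⟨le_top, le_top⟩

/-- The values of all terms stay below the base, so `φ` does not see the infinite part added to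
satisfy `T_f`. -/
theorem tSat_Tf_of_funSat (f : ℕ+ → Fin 2) {φ : sigS.Formula ℕ} (hφ : BoundedFormula.IsQF φ)
    (h : FunSat (formulaCode φ)) : TSat (Tf f) φ := by
  obtain ⟨x, -, y, -, h⟩ := h
  let := funStructure (extendDigits (formulaCode φ + 1) x)
  have : ℕ ⊨ Tf f := model_Tf_extendDigits f _ x
  have hlt : ∀ (d : Fin 0 → ℕ) (t : sigS.Term (ℕ ⊕ Fin 0)),
      t.realize (Sum.elim (digit (formulaCode φ + 1) y) d) < formulaCode φ + 1 := by
    intro d t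
    induction t using term_induction with
    | var i => exact digit_lt (Nat.succ_pos _) _ _
    | app t ih =>
      rw [realize_apply₁]
      change extendDigits _ _ _ < _
      rw [extendDigits, if_pos ih]
      exact digit_lt (Nat.succ_pos _) _ _
  suffices hw : φ.Realize (digit (formulaCode φ + 1) y) from
    ⟨Theory.ModelType.of (Tf f) ℕ, digit (formulaCode φ + 1) y, hw⟩
  refine (funEval_formulaCode (digit (formulaCode φ + 1) y) id (formulaCode φ + 1, x, y) φ hφ
    (fun _ _ _ _ h => h) (fun i _ => rfl) fun t _ => ?_).1 h
  have hI : ∀ z : ℕ, interpS ℕ z = extendDigits (formulaCode φ + 1) x z := fun _ => rfl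
  simp only [id, hI, extendDigits, if_pos (hlt _ t)]

/-- `FunSat` does not refer to `f`, so the procedure works even though `f` may be uncomputable. -/
theorem decidableTheory_Tf (f : ℕ+ → Fin 2) : DecidableTheory (Tf f) := by
  refine primrecPred_funSat.computablePred.of_eq fun c => ⟨fun h => ?_, ?_⟩
  · obtain ⟨x, hx, y, hy, hxy⟩ := id h
    obtain ⟨φ, hφ, rfl⟩ := exists_formulaCode_of_qfEval (L := sigS) _
      (exists_termCode_of_funTermEval _) (fun _ _ h => by cases h) c true hxy
    exact ⟨φ, hφ, tSat_Tf_of_funSat f hφ h, rfl⟩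
  · rintro ⟨φ, hφ, ⟨M, w, hw⟩, rfl⟩
    exact funSat_of_realize hφ hw

/-! ### The number of values -/

section CountVal

variable (f : ℕ+ → Fin 2) (i : Fin 2)

theorem countVal_one : countVal f i 1 = if f 1 = i then 1 else 0 := by
  rw [countVal, Finset.Icc_self, Finset.filter_singleton]
  split_ifs <;> rfl

theorem countVal_add_one (k : ℕ+) :
    countVal f i (k + 1) = countVal f i k + if f (k + 1) = i then 1 else 0 := by
  have h : Finset.Icc 1 (k + 1) = insert (k + 1) (Finset.Icc 1 k) := by
    ext j
    simp only [Finset.mem_Icc, one_le, true_and, Finset.mem_insert, ← PNat.coe_le_coe,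
      ← PNat.coe_inj, PNat.add_coe, PNat.one_coe]
    omega
  have hk : k + 1 ∉ (Finset.Icc 1 k).filter fun j => f j = i := by
    simp
  rw [countVal, h, Finset.filter_insert]
  split_ifs
  · rw [Finset.card_insert_of_notMem hk, countVal]
  · rfl

theorem countVal_mono : Monotone (countVal f i) := fun _ _ h =>
  Finset.card_le_card (Finset.filter_subset_filter _ (Finset.Icc_subset_Icc_right h))

theorem countVal_add_countVal (k : ℕ+) : countVal f 1 k + countVal f 0 k = k := by
  have h : ∀ x : Fin 2, x = 0 ↔ ¬ x = 1 := by decide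
  simp only [countVal, h]
  rw [Finset.card_filter_add_card_filter_not]
  simp

/-- `countVal` with `0` allowed as an argument. -/
def countBelow : ℕ → ℕ
  | 0 => 0
  | k + 1 => countBelow k + if f k.succPNat = i then 1 else 0

theorem countVal_succPNat (k : ℕ) : countVal f i k.succPNat = countBelow f i (k + 1) := by
  induction k with
  | zero =>
    rw [countBelow, countBelow, Nat.zero_add]
    exact countVal_one f i
  | succ k ih =>
    rw [countBelow, ← ih]
    exact countVal_add_one f i k.succPNat

end CountVal

/-! ### The combination of the two theories -/

theorem model_combine_iff {L₁ L₂ : FirstOrder.Language.{0, 0}} (T₁ : L₁.Theory) (T₂ : L₂.Theory)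
    (M : Type) [L₁.Structure M] [L₂.Structure M] [(L₁.sum L₂).Structure M]
    [(LHom.sumInl : L₁ →ᴸ L₁.sum L₂).IsExpansionOn M]
    [(LHom.sumInr : L₂ →ᴸ L₁.sum L₂).IsExpansionOn M] :
    M ⊨ combine T₁ T₂ ↔ M ⊨ T₁ ∧ M ⊨ T₂ := by
  rw [combine, Theory.model_union_iff, LHom.onTheory_model, LHom.onTheory_model]

/-- The combined signature. -/
abbrev sigPS : FirstOrder.Language.{0, 0} := sigP.sum sigS

/-- The predicate `Pₙ` as a formula of the combined signature. -/
def predF (n : ℕ+) : sigPS.Formula ℕ :=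
  ((LHom.sumInl : sigP →ᴸ sigPS).onRelation (symP n)).formula default

/-- The variable `xᵢ`. -/
def varT (i : ℕ) : sigPS.Term (ℕ ⊕ Fin 0) := Term.var (Sum.inl i)

/-- `s(xᵢ) = xᵢ`. -/
def fixedVarF (i : ℕ) : sigPS.Formula ℕ :=
  Term.bdEqual (((LHom.sumInr : sigS →ᴸ sigPS).onFunction symS).apply₁ (varT i)) (varT i)

/-- `xₘ` is different from `x₀, …, xᵢ₋₁`. -/
def newVarF (m : ℕ) : ℕ → sigPS.Formula ℕ
  | 0 => ⊤
  | i + 1 => newVarF m i ⊓ (Term.bdEqual (varT i) (varT m)).not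

/-- `x₀, …, xₘ₋₁` are pairwise distinct fixed points of `s`. -/
def fixedVarsF : ℕ → sigPS.Formula ℕ
  | 0 => ⊤
  | m + 1 => fixedVarsF m ⊓ (fixedVarF m ⊓ newVarF m m)

/-- `Pₙ`, and `x₀, …, xₘ₋₁` are pairwise distinct fixed points of `s`. -/
def queryF (n : ℕ+) (m : ℕ) : sigPS.Formula ℕ := predF n ⊓ fixedVarsF m

theorem isQF_queryF (n : ℕ+) (m : ℕ) : BoundedFormula.IsQF (queryF n m) := by
  have hnew : ∀ m i, BoundedFormula.IsQF (newVarF m i) := fun m i => by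
    induction i with
    | zero => exact BoundedFormula.IsQF.top
    | succ i ih => exact ih.inf (BoundedFormula.IsAtomic.equal _ _).isQF.not
  have hfix : BoundedFormula.IsQF (fixedVarsF m) := by
    induction m with
    | zero => exact BoundedFormula.IsQF.top
    | succ m ih => exact ih.inf ((BoundedFormula.IsAtomic.equal _ _).isQF.inf (hnew m m))
  exact (BoundedFormula.IsAtomic.rel _ _).isQF.inf hfix

section Realize

variable {M : Type} [sigP.Structure M] [sigS.Structure M] [sigPS.Structure M]
  [(LHom.sumInl : sigP →ᴸ sigPS).IsExpansionOn M] [(LHom.sumInr : sigS →ᴸ sigPS).IsExpansionOn M]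

theorem realize_queryF (n : ℕ+) (m : ℕ) (v : ℕ → M) :
    (queryF n m).Realize v ↔ Structure.RelMap (symP n) (default : Fin 0 → M) ∧
      (∀ i < m, v i ∈ fixedSet M) ∧ Set.InjOn v (Set.Iio m) := by
  have hpred : (predF n).Realize v ↔ Structure.RelMap (symP n) (default : Fin 0 → M) := by
    rw [predF, Formula.realize_rel, Subsingleton.elim (fun i => Term.realize _ _) default]
    exact iff_of_eq ((LHom.sumInl : sigP →ᴸ sigPS).map_onRelation (symP n) default)
  have hfixed : ∀ i, (fixedVarF i).Realize v ↔ v i ∈ fixedSet M := fun i => by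
    rw [fixedVarF, Formula.Realize, BoundedFormula.realize_bdEqual, Functions.apply₁,
      Term.realize_func]
    have : (fun j => (![varT i] j).realize (Sum.elim v default)) = fun _ => v i := by
      funext j
      rw [Subsingleton.elim j 0]
      rfl
    rw [this]
    have h := (LHom.sumInr : sigS →ᴸ sigPS).map_onFunction symS fun _ => v i
    exact ⟨fun e => h.symm.trans e, fun e => h.trans e⟩
  have hnew : ∀ m i, (newVarF m i).Realize v ↔ ∀ j < i, v j ≠ v m := fun m i => by
    induction i with
    | zero => simp [newVarF, Formula.Realize]
    | succ i ih =>
      rw [newVarF, Formula.realize_inf, ih, Formula.realize_not, Nat.forall_lt_succ_right]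
      rfl
  have hvars : (fixedVarsF m).Realize v ↔
      (∀ i < m, v i ∈ fixedSet M) ∧ Set.InjOn v (Set.Iio m) := by
    induction m with
    | zero => simp [fixedVarsF, Formula.Realize]
    | succ m ih =>
      rw [fixedVarsF, Formula.realize_inf, Formula.realize_inf, ih, hfixed, hnew,
        Nat.forall_lt_succ_right]
      have : Set.Iio (m + 1) = insert m (Set.Iio m) := by
        ext j
        simp only [Set.mem_Iio, Set.mem_insert_iff]
        omega
      rw [this, Set.injOn_insert (by simp)]
      simp only [Set.mem_image, Set.mem_Iio, not_exists, not_and]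
      tauto
  rw [queryF, Formula.realize_inf, hpred, hvars]

end Realize

/-- Under `Pₙ` the fixed and non-fixed points number `n` in total, and so do `f₁(n)` and `f₀(n)`;
the axiom for `k = n` then leaves no freedom. -/
theorem tSat_queryF_iff {f : ℕ+ → Fin 2} (h1 : f 1 = 1) (n : ℕ+) (m : ℕ) :
    TSat (combine Teq (Tf f)) (queryF n m) ↔ m ≤ countVal f 1 n := by
  constructor
  · rintro ⟨M, v, hv⟩
    let := (LHom.sumInl : sigP →ᴸ sigPS).reduct M
    let := (LHom.sumInr : sigS →ᴸ sigPS).reduct M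
    have hmodel : M ⊨ combine Teq (Tf f) := M.is_model
    rw [model_combine_iff] at hmodel
    rw [realize_queryF] at hv
    obtain ⟨hP, hfix, hinj⟩ := hv
    have hcard : (Set.univ : Set M).encard = (n : ℕ) := by
      rw [Set.encard_univ, ENat.card, model_Teq_iff.1 hmodel.1 n hP, map_natCast]
    have hsum : (fixedSet M).encard + (fixedSet M)ᶜ.encard = (n : ℕ) := by
      rw [Set.encard_add_encard_compl, hcard]
    have hle : (m : ℕ∞) ≤ (fixedSet M).encard := by
      have : (v '' Set.Iio m).encard = m := by
        rw [hinj.encard_image, Set.encard_eq_coe_toFinset_card]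
        simp
      rw [← this]
      exact Set.encard_le_encard (Set.image_subset_iff.2 hfix)
    obtain ⟨a, ha⟩ := ENat.ne_top_iff_exists.1 (fun h => by simp [h] at hsum :
      (fixedSet M).encard ≠ ⊤)
    obtain ⟨b, hb⟩ := ENat.ne_top_iff_exists.1 (fun h => by simp [h] at hsum :
      (fixedSet M)ᶜ.encard ≠ ⊤)
    have key := (model_Tf_iff f).1 hmodel.2 n
    rw [← ha] at hle
    simp only [← ha, ← hb] at key hsum
    norm_cast at key hsum hle
    have hn := countVal_add_countVal f n
    rcases key with ⟨h₁, h₂⟩ | ⟨i, -, h₁, h₂⟩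
    · omega
    · have hi := countVal_add_countVal f i
      -- The two exact counts add up to `i`, and also to the size `n`.
      have : i = n := PNat.eq (by omega)
      subst this
      omega
  · intro hm
    -- Because `f(1) = 1`, the element `z` is itself one of the intended fixed points, so sending
    -- the other elements to `z` creates no further ones.
    have hpos : 0 < countVal f 1 n := by
      have := countVal_mono f 1 (one_le (a := n))
      rw [countVal_one, if_pos h1] at this
      omega
    have hn := countVal_add_countVal f n
    let z : Fin n := ⟨0, n.pos⟩
    let := predStructure (Fin n) n
    let := funStructure fun x : Fin n => if (x : ℕ) < countVal f 1 n then x else z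
    have : Nonempty (Fin n) := ⟨z⟩
    have hTeq : Fin n ⊨ Teq := model_predStructure (Or.inr (Cardinal.mk_fin _))
    have hset : fixedSet (Fin n) = {x : Fin n | (x : ℕ) < countVal f 1 n} := by
      ext x
      change (if (x : ℕ) < countVal f 1 n then x else z) = x ↔ (x : ℕ) < countVal f 1 n
      split_ifs with h
      · exact iff_of_true rfl h
      · refine iff_of_false (fun e => h ?_) h
        rw [← e]
        exact hpos
    have hfix : (fixedSet (Fin n)).encard = countVal f 1 n := by
      have himg : (Fin.val '' fixedSet (Fin n)) = Set.Iio (countVal f 1 n) := by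
        rw [hset]
        ext i
        simp only [Set.mem_image, Set.mem_ofPred_eq, Set.mem_Iio]
        exact ⟨fun ⟨x, hx, hxi⟩ => hxi ▸ hx, fun hi => ⟨⟨i, by omega⟩, hi, rfl⟩⟩
      rw [← Fin.val_injective.encard_image, himg, Set.encard_eq_coe_toFinset_card]
      simp
    have hnon : (fixedSet (Fin n))ᶜ.encard = countVal f 0 n := by
      have hs := Set.encard_add_encard_compl (fixedSet (Fin n))
      rw [hfix, Set.encard_univ, ENat.card_eq_coe_fintype_card, Fintype.card_fin] at hs
      obtain ⟨b, hb⟩ := ENat.ne_top_iff_exists.1 (fun h => by simp [h] at hs :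
        (fixedSet (Fin n))ᶜ.encard ≠ ⊤)
      rw [← hb] at hs ⊢
      norm_cast at hs ⊢
      omega
    have hTf : Fin n ⊨ Tf f := by
      refine (model_Tf_iff f).2 fun k => ?_
      rw [hfix, hnon]
      -- Axioms up to `n` hold by monotonicity of the counts, later ones through their disjunct `i =
      -- n`.
      rcases le_total k n with h | h
      · left
        exact ⟨by exact_mod_cast countVal_mono f 1 h, by exact_mod_cast countVal_mono f 0 h⟩
      · exact Or.inr ⟨n, h, rfl, rfl⟩
    have hmodel : Fin n ⊨ combine Teq (Tf f) := (model_combine_iff _ _ _).2 ⟨hTeq, hTf⟩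
    have hv : (queryF n m).Realize fun i => if h : i < (n : ℕ) then (⟨i, h⟩ : Fin n) else z := by
      refine (realize_queryF n m _).2 ⟨rfl, fun i hi => ?_, fun i hi j hj hij => ?_⟩
      · rw [hset, dif_pos (by omega)]
        exact hi.trans_le hm
      · have hi : i < m := hi
        have hj : j < m := hj
        simp only [dif_pos (show i < (n : ℕ) by omega), dif_pos (show j < (n : ℕ) by omega)] at hij
        exact Fin.mk.inj_iff.1 hij
    exact ⟨Theory.ModelType.of (combine Teq (Tf f)) (Fin n), _, hv⟩

/-! ### Computing the Gödel number of a query -/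

theorem primrec_impCode : Primrec₂ fun a b : ℕ => Nat.pair 3 (Nat.pair a b) :=
  Primrec₂.natPair.comp (Primrec.const 3) Primrec₂.natPair

/-- The code of a conjunction. -/
def andCode (a b : ℕ) : ℕ :=
  Nat.pair 3 (Nat.pair (Nat.pair 3 (Nat.pair a (Nat.pair 3 (Nat.pair b 0)))) 0)

theorem primrec_andCode : Primrec₂ andCode :=
  primrec_impCode.comp (primrec_impCode.comp Primrec.fst
    (primrec_impCode.comp Primrec.snd (Primrec.const 0))) (Primrec.const 0)

/-- `φ ⊓ ψ` unfolds to `(φ → (ψ → ⊥)) → ⊥`, and `⊥` has code `0`. -/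
theorem formulaCode_inf (φ ψ : sigPS.Formula ℕ) :
    formulaCode (φ ⊓ ψ) = andCode (formulaCode φ) (formulaCode ψ) := rfl

/-- The code of the variable `xᵢ`. -/
def varCode (i : ℕ) : ℕ := Nat.pair 0 (2 * i)

theorem primrec_varCode : Primrec varCode :=
  Primrec₂.natPair.comp (Primrec.const 0) (Primrec.nat_mul.comp (Primrec.const 2) Primrec.id)

theorem primrec_formulaCode_fixedVarF : Primrec fun i => formulaCode (fixedVarF i) := by
  have h : Primrec fun i => Nat.pair 1 (Nat.pair (Nat.pair 1 (Nat.pair 1 (Nat.pair 1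
      (Nat.pair (varCode i) 0 + 1)))) (varCode i)) := by
    refine Primrec₂.natPair.comp (Primrec.const 1) (Primrec₂.natPair.comp ?_ primrec_varCode)
    refine Primrec₂.natPair.comp (Primrec.const 1) (Primrec₂.natPair.comp (Primrec.const 1) ?_)
    exact Primrec₂.natPair.comp (Primrec.const 1) (Primrec.succ.comp
      (Primrec₂.natPair.comp primrec_varCode (Primrec.const 0)))
  refine h.of_eq fun i => ?_
  -- In the sum signature `Sum.inr` sends code `c` to `2 * c + 1`, and `s` has code `0`.
  have hs : Encodable.encode ((LHom.sumInr : sigS →ᴸ sigPS).onFunction symS) = 1 := rfl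
  have hv : termCode (varT i) = varCode i := rfl
  rw [fixedVarF, Term.bdEqual, formulaCode, Functions.apply₁, termCode, hs, hv, List.ofFn_succ,
    List.ofFn_zero, Encodable.encode_list_cons, Encodable.encode_list_nil]
  rfl

theorem primrec_formulaCode_newVarF : Primrec₂ fun m i => formulaCode (newVarF m i) := by
  -- The start value is the code of `⊤`, which is `⊥ → ⊥`.
  have h : Primrec₂ fun m i : ℕ => (Nat.rec (Nat.pair 3 (Nat.pair 0 0)) (fun i c =>
      andCode c (Nat.pair 3 (Nat.pair (Nat.pair 1 (Nat.pair (varCode i) (varCode m))) 0))) i : ℕ) := by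
    refine Primrec.nat_rec (f := fun _ => Nat.pair 3 (Nat.pair 0 0)) (g := fun m p =>
      andCode p.2 (Nat.pair 3 (Nat.pair (Nat.pair 1 (Nat.pair (varCode p.1) (varCode m))) 0)))
      (Primrec.const _) ?_
    refine primrec_andCode.comp (Primrec.snd.comp Primrec.snd)
      (primrec_impCode.comp ?_ (Primrec.const 0))
    exact Primrec₂.natPair.comp (Primrec.const 1) (Primrec₂.natPair.comp
      (primrec_varCode.comp (Primrec.fst.comp Primrec.snd)) (primrec_varCode.comp Primrec.fst))
  refine h.of_eq fun m i => ?_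
  induction i with
  | zero => rfl
  | succ i ih =>
    rw [newVarF, formulaCode_inf, ← ih]
    rfl

theorem primrec_formulaCode_fixedVarsF : Primrec fun m => formulaCode (fixedVarsF m) := by
  have h : Primrec fun m : ℕ => (Nat.rec (Nat.pair 3 (Nat.pair 0 0)) (fun m c =>
      andCode c (andCode (formulaCode (fixedVarF m)) (formulaCode (newVarF m m)))) m : ℕ) := by
    refine Primrec.nat_rec₁ _ (primrec_andCode.comp Primrec.snd (primrec_andCode.comp ?_ ?_))
    · exact primrec_formulaCode_fixedVarF.comp Primrec.fst
    · exact primrec_formulaCode_newVarF.comp Primrec.fst Primrec.fst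
  refine h.of_eq fun m => ?_
  induction m with
  | zero => rfl
  | succ m ih => rw [fixedVarsF, formulaCode_inf, formulaCode_inf, ← ih]

theorem primrec_formulaCode_queryF :
    Primrec₂ fun (k : ℕ) (m : ℕ) => formulaCode (queryF k.succPNat m) := by
  have h : Primrec fun k : ℕ => formulaCode (predF k.succPNat) := by
    -- `Sum.inl` doubles the code `k + 1` of the predicate.
    have h' : Primrec fun k : ℕ => Nat.pair 2 (Nat.pair 0 (Nat.pair (2 * (k + 1)) 0)) :=
      Primrec₂.natPair.comp (Primrec.const 2) (Primrec₂.natPair.comp (Primrec.const 0)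
        (Primrec₂.natPair.comp (Primrec.nat_mul.comp (Primrec.const 2) Primrec.succ)
          (Primrec.const 0)))
    exact h'.of_eq fun k => rfl
  exact primrec_andCode.comp (h.comp Primrec.fst) (primrec_formulaCode_fixedVarsF.comp Primrec.snd)

/-- Once the number `c` of ones among the first `k` values is known, the query whether `c + 1`
distinct fixed points fit into size `k + 1` reveals the next value, and so the next count. -/
theorem not_decidableTheory_combine {f : ℕ+ → Fin 2} (h1 : f 1 = 1)
    (hf : ¬ Computable fun n : ℕ => f n.succPNat) : ¬ DecidableTheory (combine Teq (Tf f)) := by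
  rintro ⟨hdec, hcomp⟩
  refine hf ?_
  let D : ℕ → Bool := fun c => @decide _ (hdec c)
  have hsat : ∀ k m, (∃ φ : sigPS.Formula ℕ, BoundedFormula.IsQF φ ∧
      TSat (combine Teq (Tf f)) φ ∧ formulaCode φ = formulaCode (queryF k m)) ↔
      m ≤ countVal f 1 k := by
    intro k m
    rw [← tSat_queryF_iff h1]
    refine ⟨?_, fun h => ⟨_, isQF_queryF k m, h, rfl⟩⟩
    rintro ⟨φ, -, h, hc⟩
    rwa [← formulaCode_injective hc]
  have hD : ∀ k, D (formulaCode (queryF k.succPNat (countBelow f 1 k + 1))) = true ↔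
      f k.succPNat = 1 := by
    intro k
    refine decide_eq_true_iff.trans ((hsat _ _).trans ?_)
    rw [countVal_succPNat, countBelow]
    split_ifs with h <;> simp [h]
  have hDc : Computable₂ fun (k c : ℕ) => D (formulaCode (queryF k.succPNat (c + 1))) :=
    hcomp.comp (primrec_formulaCode_queryF.comp Primrec.fst
      (Primrec.succ.comp Primrec.snd)).to_comp
  have hcount : Computable (countBelow f 1) := by
    have h : Computable fun k : ℕ => (Nat.rec 0 (fun k c =>
        c + bif D (formulaCode (queryF k.succPNat (c + 1))) then 1 else 0) k : ℕ) := by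
      refine Computable.nat_rec (f := id) (g := fun _ => 0) (h := fun _ p => p.2 +
        bif D (formulaCode (queryF p.1.succPNat (p.2 + 1))) then 1 else 0)
        Computable.id (Computable.const 0) ?_
      refine Primrec.nat_add.to_comp.comp (Computable.snd.comp Computable.snd)
        (Computable.cond (hDc.comp (Computable.fst.comp Computable.snd)
          (Computable.snd.comp Computable.snd)) (Computable.const 1) (Computable.const 0))
    refine h.of_eq fun k => ?_
    induction k with
    | zero => rfl
    | succ k ih =>
      change _ + cond _ _ _ = _
      rw [ih, countBelow, Bool.cond_eq_ite]
      simp only [hD]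
  refine (Computable.cond (hDc.comp Computable.id hcount) (Computable.const (1 : Fin 2))
    (Computable.const 0)).of_eq fun k => ?_
  rw [Bool.cond_eq_ite]
  simp only [id, hD]
  split_ifs with h
  · exact h.symm
  · omega

/-! ### Admissible functions -/

/-- The halting predicate, transferred from programs to their code numbers. -/
theorem exists_not_computable : ∃ h : ℕ → Bool, ¬ Computable h := by
  classical
  refine ⟨fun n => decide (∃ c : Nat.Partrec.Code, Encodable.encode c = n ∧ (c.eval 0).Dom),
    fun h => ComputablePred.halting_problem 0 ⟨Classical.decPred _, ?_⟩⟩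
  refine (h.comp Computable.encode).of_eq fun c => decide_eq_decide.2 ?_
  constructor
  · rintro ⟨c', hc, hd⟩
    rwa [← Encodable.encode_injective hc]
  · exact fun hd => ⟨c, rfl, hd⟩

/-- The values at `2j + 1` and `2j + 2` are `b j` and `1 - b j`, so every initial segment of even
length is balanced. Setting `b 0 = 1` gives `f(1) = 1`, and the shifted `b` carries a noncomputable
`h`. -/
theorem exists_admissible : ∃ f : ℕ+ → Fin 2, Admissible f := by
  obtain ⟨h, hh⟩ := exists_not_computable
  let b : ℕ → Fin 2 := fun j => if j = 0 ∨ h (j - 1) = true then 1 else 0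
  let f : ℕ+ → Fin 2 := fun n =>
    if n.natPred % 2 = 0 then b (n.natPred / 2) else 1 - b (n.natPred / 2)
  have heven : ∀ j, f (2 * j).succPNat = b j := fun j => by simp [f]
  have hodd : ∀ j, f (2 * j + 1).succPNat = 1 - b j := fun j => by
    have : (2 * j + 1) / 2 = j := by omega
    simp [f, Nat.add_mod, this]
  have hcount : ∀ i j, countBelow f i (2 * j) = j := fun i j => by
    induction j with
    | zero => rfl
    | succ j ih =>
      rw [Nat.mul_succ, countBelow, countBelow, ih, heven, hodd, add_assoc]
      congr 1
      have key : ∀ i x : Fin 2, (if x = i then 1 else 0) + (if 1 - x = i then 1 else 0) = 1 := by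
        decide
      exact key i (b j)
  refine ⟨f, fun hf => hh ?_, (heven 0).trans (by simp [b]), fun k hk => ?_⟩
  · have hp : Primrec fun k : ℕ => 2 * (k + 1) :=
      Primrec.nat_mul.comp (Primrec.const 2) Primrec.succ
    have hc : Computable fun k : ℕ => decide (f (2 * (k + 1)).succPNat = 1) :=
      Primrec.eq.decide.to_comp.comp (hf.comp hp.to_comp) (Computable.const 1)
    refine hc.of_eq fun k => ?_
    rw [heven]
    cases hk : h k <;> simp [b, hk]
  · obtain ⟨k, rfl⟩ := Nat.exists_eq_add_of_le' hk
    have hpos : 1 ≤ 2 * 2 ^ k := Nat.mul_pos two_pos (Nat.two_pow_pos k)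
    have hpow : (2 ^ (k + 1) : ℕ+) = (2 * 2 ^ k - 1 : ℕ).succPNat := by
      apply PNat.eq
      rw [Nat.succPNat_coe, Nat.succ_eq_add_one, Nat.sub_add_cancel hpos, PNat.pow_coe,
        pow_succ']
      rfl
    rw [hpow, countVal_succPNat, countVal_succPNat, Nat.sub_add_cancel hpos, hcount,
      hcount]

end TheoryCombination

theorem mainTheorem5 :
    (∃ f : ℕ+ → Fin 2, TheoryCombination.Admissible f) ∧
    ∀ f : ℕ+ → Fin 2, TheoryCombination.Admissible f →
      TheoryCombination.DecidableTheory TheoryCombination.Teq ∧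
      TheoryCombination.DecidableTheory (TheoryCombination.Tf f) ∧
      TheoryCombination.Gentle TheoryCombination.Teq ∧
      ¬ TheoryCombination.DecidableTheory
          (TheoryCombination.combine TheoryCombination.Teq (TheoryCombination.Tf f)) :=
  ⟨TheoryCombination.exists_admissible, fun f hf =>
    ⟨TheoryCombination.decidableTheory_Teq, TheoryCombination.decidableTheory_Tf f,
      TheoryCombination.gentle_Teq,
      TheoryCombination.not_decidableTheory_combine hf.map_one hf.not_computable⟩⟩
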